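/- Let $G$ be a countable discrete group which is amenable and residually finite. Let $(F_n)_{n\ge 1}$ be a (right) Følner sequence of $G$, i.e. a sequence of finite sets $e\in F_1\subset F_2\subset\cdots\subset G$ with $\bigcup_n F_n=G$ and $\lim_{n\to\infty}|F_n\triangle F_ns|/|F_n|=0$ for every $s\in G$. For every $n$ let $K_n\subset G$ be a finite set with $F_n\subset K_n$ and let $L_n$ be a normal subgroup of finite index in $G$ such that $G=K_nL_n$ is a tiling, i.e. $G$ is the disjoint union of the translates $K_nl$, $l\in L_n$. Let $A$ be a unital separable C*-algebra and let $\alpha:G\to\operatorname{Aut}(A)$ be a homomorphism into the group of $*$-automorphisms of $A$ such that $$\lim_{n\to\infty}\Bigl(\max_{l\in L_n\cap K_nK_n^{-1}F_n}\|\alpha(l)a-a\|\Bigr)=0\qquad\text{for all }a\in A.$$ If $A$ is quasidiagonal, then the (full) crossed product $A\rtimes_\alpha G$ is quasidiagonal. Here the crossed product is the completion of the $*$-algebra of finitely supported functions $G\to A$ (with the $\alpha$-twisted convolution) in the universal norm, i.e. the supremum of the norms in all covariant representations. A C*-algebra is quasidiagonal if it has a faithful representation on a separable Hilbert space $\mathcal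 H$ whose image $\mathcal A$ is a (norm-separable) quasidiagonal set of operators, i.e. there are finite rank self-adjoint projections $P_n$ in $\mathcal{B}(\mathcal H)$, converging strongly to the identity, such that $\lim_{n\to\infty}\|TP_n-P_nT\|=0$ for every $T$ in some subset of $\mathcal A$ with dense linear span in $\mathcal A$. -/

import Mathlib

open Filter Topology
open scoped Pointwise symmDiff

universe u v w

noncomputable section

/-! ### Quasidiagonality -/

/-- A set `S` of bounded operators on a Hilbert space is *quasidiagonal* if it is (norm) separable
and there is a sequence of finite rank self-adjoint projections `P n`, converging strongly to the
identity, such that `‖[T, P n]‖ → 0` for every `T` in some subset `D` of `S` whose linear span is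
dense in `S`. -/
def IsQuasidiagonalSet {H : Type w} [NormedAddCommGroup H] [InnerProductSpace ℂ H]
    [CompleteSpace H] (S : Set (H →L[ℂ] H)) : Prop :=
  TopologicalSpace.IsSeparable S ∧
  ∃ P : ℕ → (H →L[ℂ] H),
    (∀ n, IsStarProjection (P n) ∧ FiniteDimensional ℂ (LinearMap.range (P n).toLinearMap)) ∧
    (∀ h : H, Tendsto (fun n => P n h) atTop (𝓝 h)) ∧
    ∃ D : Set (H →L[ℂ] H), D ⊆ S ∧ S ⊆ closure (Submodule.span ℂ D : Set (H →L[ℂ] H)) ∧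
      ∀ T ∈ D, Tendsto (fun n => ‖T * P n - P n * T‖) atTop (𝓝 0)

/-- A unital C⋆-algebra is *quasidiagonal* if it has a faithful representation on a separable
Hilbert space whose range is a quasidiagonal set of operators. -/
def IsQuasidiagonal (B : Type w) [CStarAlgebra B] : Prop :=
  ∃ (H : Type w) (_ : NormedAddCommGroup H) (_ : InnerProductSpace ℂ H) (_ : CompleteSpace H)
    (_ : TopologicalSpace.SeparableSpace H) (ρ : B →⋆ₐ[ℂ] (H →L[ℂ] H)),
    Function.Injective ρ ∧ IsQuasidiagonalSet (Set.range ρ)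

/-! ### Følner sequences -/

open scoped Classical in
/-- A *(right) Følner sequence* of a discrete group: an increasing sequence of finite sets
containing the identity, with union the whole group, which is asymptotically invariant
under right translations. -/
structure IsFolnerSequence {G : Type v} [Group G] (F : ℕ → Finset G) : Prop where
  one_mem : (1 : G) ∈ F 0
  mono : Monotone F
  exhausts : ∀ g : G, ∃ n, g ∈ F n
  tendsto_symmDiff : ∀ s : G,
    Tendsto (fun n => ((F n ∆ (F n).image (fun x => x * s)).card : ℝ) / ((F n).card : ℝ))
      atTop (𝓝 0)

/-! ### The full crossed product -/

section CrossedProduct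

variable {A : Type u} [CStarAlgebra A] {G : Type v} [Group G]

/-- The action of `G` on `A` by ring automorphisms underlying `α`. -/
abbrev mulSemiringActionOf (α : G →* (A ≃⋆ₐ[ℂ] A)) : MulSemiringAction G A where
  smul g a := α g a
  one_smul a := by change α 1 a = a; rw [map_one]; rfl
  mul_smul g h a := by change α (g * h) a = α g (α h a); rw [map_mul]; rfl
  smul_zero g := map_zero (α g)
  smul_add g := map_add (α g)
  smul_one g := map_one (α g)
  smul_mul g := map_mul (α g)

/-- The space `C_c(G, A)` of finitely supported functions on `G` with values in `A`; it is made
into a ⋆-algebra by the `α`-twisted convolution. -/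
def TwistedConv (_α : G →* (A ≃⋆ₐ[ℂ] A)) : Type (max u v) := SkewMonoidAlgebra A G

namespace TwistedConv

variable (α : G →* (A ≃⋆ₐ[ℂ] A))

/-- The ring structure, `(a δ_g) (b δ_h) = a α_g(b) δ_{gh}`. -/
instance : Ring (TwistedConv α) :=
  letI := mulSemiringActionOf α
  inferInstanceAs (Ring (SkewMonoidAlgebra A G))

instance : Module ℂ (TwistedConv α) := inferInstanceAs (Module ℂ (SkewMonoidAlgebra A G))

/-- The function with value `a` at `g` and `0` elsewhere. -/
def single (g : G) : A →ₗ[ℂ] TwistedConv α := SkewMonoidAlgebra.lsingle ℂ g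

variable {α}

theorem single_mul_single (g h : G) (a b : A) :
    single α g a * single α h b = single α (g * h) (a * α g b) :=
  letI := mulSemiringActionOf α
  SkewMonoidAlgebra.single_mul_single

theorem one_def : (1 : TwistedConv α) = single α 1 1 := rfl

@[elab_as_elim]
theorem induction {p : TwistedConv α → Prop} (f : TwistedConv α) (zero : p 0)
    (single : ∀ g a, p (single α g a)) (add : ∀ f g, p f → p g → p (f + g)) : p f :=
  SkewMonoidAlgebra.induction_on f zero single (fun f g => add f g)

variable (α) in
/-- The additive map on `C_c(G, A)` determined by its values on the functions `single g a`. -/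
def liftAdd {N : Type*} [AddCommMonoid N] (φ : G → A →+ N) : TwistedConv α →+ N :=
  (Finsupp.liftAddHom φ).comp
    (SkewMonoidAlgebra.coeffAddEquiv (k := A) (G := G)).toAddMonoidHom

@[simp]
theorem liftAdd_single {N : Type*} [AddCommMonoid N] (φ : G → A →+ N) (g : G) (a : A) :
    liftAdd α φ (single α g a) = φ g a :=
  Finsupp.liftAddHom_apply_single φ g a

instance : Algebra ℂ (TwistedConv α) :=
  Algebra.ofModule
    (fun c x y => by
      induction x using induction with
      | zero => simp
      | add x x' hx hx' => simp only [smul_add, add_mul, hx, hx']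
      | single g a =>
        induction y using induction with
        | zero => simp
        | add y y' hy hy' => simp only [mul_add, hy, hy', smul_add]
        | single h b => simp only [← map_smul, single_mul_single, smul_mul_assoc])
    (fun c x y => by
      induction x using induction with
      | zero => simp
      | add x x' hx hx' => simp only [smul_add, add_mul, hx, hx']
      | single g a =>
        induction y using induction with
        | zero => simp
        | add y y' hy hy' => simp only [mul_add, hy, hy', smul_add]
        | single h b =>
          simp only [← map_smul (single α _), single_mul_single, map_smul (α g), mul_smul_comm])

/-- The involution, `(a δ_g)^* = α_{g⁻¹}(a^*) δ_{g⁻¹}`. -/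
instance : Star (TwistedConv α) where
  star := liftAdd α fun g =>
    (single α g⁻¹).toAddMonoidHom.comp
      ((α g⁻¹ : A ≃⋆ₐ[ℂ] A).toRingEquiv.toAddEquiv.toAddMonoidHom.comp
        (starAddEquiv : A ≃+ A).toAddMonoidHom)

theorem star_single (g : G) (a : A) :
    star (single α g a) = single α g⁻¹ (α g⁻¹ (star a)) :=
  liftAdd_single _ g a

theorem star_add' (x y : TwistedConv α) : star (x + y) = star x + star y :=
  map_add (liftAdd α _) x y

theorem star_zero' : star (0 : TwistedConv α) = 0 :=
  map_zero (liftAdd α _)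

theorem action_mul_apply (g h : G) (a : A) : α g (α h a) = α (g * h) a := by
  rw [map_mul]; rfl

theorem action_one_apply (a : A) : α 1 a = a := by
  rw [map_one]; rfl

instance : StarRing (TwistedConv α) where
  star_involutive x := by
    induction x using induction with
    | zero => simp only [star_zero']
    | add x y hx hy => simp only [star_add', hx, hy]
    | single g a =>
      simp only [star_single, ← map_star, action_mul_apply, star_star, inv_inv, mul_inv_cancel,
        action_one_apply]
  star_add := star_add'
  star_mul x y := by
    induction x using induction with
    | zero => simp only [zero_mul, mul_zero, star_zero']
    | add x x' hx hx' => simp only [star_add', add_mul, mul_add, hx, hx']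
    | single g a =>
      induction y using induction with
      | zero => simp only [zero_mul, mul_zero, star_zero']
      | add y y' hy hy' => simp only [star_add', add_mul, mul_add, hy, hy']
      | single h b =>
        simp only [star_single, single_mul_single, map_mul (α _), ← map_star, action_mul_apply,
          star_mul, mul_inv_rev, inv_mul_cancel_right]

instance : StarModule ℂ (TwistedConv α) where
  star_smul c x := by
    induction x using induction with
    | zero => simp
    | add x y hx hy => simp only [smul_add, star_add, hx, hy]
    | single g a => simp only [← map_smul, star_single, star_smul]

end TwistedConv

/-- A *covariant representation* `(σ, u, H)` of the action `α`: a (unital) ⋆-representation `σ` of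
`A` and a unitary representation `u` of `G` with `u(s) σ(a) u(s)^* = σ(α(s) a)`. -/
structure CovariantRep (α : G →* (A ≃⋆ₐ[ℂ] A)) (H : Type w) [NormedAddCommGroup H]
    [InnerProductSpace ℂ H] [CompleteSpace H] where
  /-- The representation of the algebra. -/
  σ : A →⋆ₐ[ℂ] (H →L[ℂ] H)
  /-- The representation of the group. -/
  u : G →* unitary (H →L[ℂ] H)
  covariant : ∀ (s : G) (a : A),
    (u s : H →L[ℂ] H) * σ a * star (u s : H →L[ℂ] H) = σ (α s a)

namespace CovariantRep

variable {α : G →* (A ≃⋆ₐ[ℂ] A)} {H : Type w} [NormedAddCommGroup H]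
    [InnerProductSpace ℂ H] [CompleteSpace H] (π : CovariantRep α H)

theorem u_mul_σ (s : G) (a : A) :
    (π.u s : H →L[ℂ] H) * π.σ a = π.σ (α s a) * (π.u s : H →L[ℂ] H) := by
  rw [← π.covariant, mul_assoc _ (star _), Unitary.coe_star_mul_self, mul_one]

def integratedAdd : TwistedConv α →+ (H →L[ℂ] H) :=
  TwistedConv.liftAdd α fun s =>
    (AddMonoidHom.mulRight (π.u s : H →L[ℂ] H)).comp (π.σ : A →+* (H →L[ℂ] H)).toAddMonoidHom

theorem integratedAdd_single (s : G) (a : A) :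
    π.integratedAdd (TwistedConv.single α s a) = π.σ a * (π.u s : H →L[ℂ] H) :=
  TwistedConv.liftAdd_single _ s a

theorem integratedAdd_smul (c : ℂ) (x : TwistedConv α) :
    π.integratedAdd (c • x) = c • π.integratedAdd x := by
  induction x using TwistedConv.induction with
  | zero => simp
  | add x y hx hy => simp only [smul_add, map_add, hx, hy]
  | single g a => simp only [← map_smul (TwistedConv.single α g), integratedAdd_single, map_smul π.σ,
      smul_mul_assoc]

theorem integratedAdd_one : π.integratedAdd 1 = 1 := by
  simp [TwistedConv.one_def, integratedAdd_single]

/-- The ⋆-representation `f ↦ ∑ s, σ(f(s)) u(s)` of `C_c(G, A)` corresponding to a covariant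
representation. -/
def integrated : TwistedConv α →⋆ₐ[ℂ] (H →L[ℂ] H) where
  toFun := π.integratedAdd
  map_one' := π.integratedAdd_one
  map_zero' := map_zero _
  map_add' := map_add _
  commutes' c := by
    simp only [Algebra.algebraMap_eq_smul_one, integratedAdd_smul, integratedAdd_one]
  map_mul' x y := by
    induction x using TwistedConv.induction with
    | zero => simp
    | add x x' hx hx' => simp only [add_mul, map_add, hx, hx']
    | single g a =>
      induction y using TwistedConv.induction with
      | zero => simp
      | add y y' hy hy' => simp only [mul_add, map_add, hy, hy']
      | single h b =>
        simp only [TwistedConv.single_mul_single, integratedAdd_single, map_mul,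
          Submonoid.coe_mul]
        rw [mul_assoc (π.σ a) (π.u g : H →L[ℂ] H), ← mul_assoc (π.u g : H →L[ℂ] H), u_mul_σ]
        simp only [mul_assoc]
  map_star' x := by
    induction x using TwistedConv.induction with
    | zero => simp
    | add x y hx hy => simp only [star_add, map_add, hx, hy]
    | single g a =>
      have h : (star (π.u g : H →L[ℂ] H)) = (π.u g⁻¹ : H →L[ℂ] H) := by
        rw [map_inv, ← Unitary.star_eq_inv, Unitary.coe_star]
      simp only [TwistedConv.star_single, integratedAdd_single, star_mul, h, ← map_star, u_mul_σ]

@[simp]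
theorem integrated_single (s : G) (a : A) :
    π.integrated (TwistedConv.single α s a) = π.σ a * (π.u s : H →L[ℂ] H) :=
  π.integratedAdd_single s a

theorem exists_norm_integrated_le (x : TwistedConv α) :
    ∃ C : ℝ, ∀ (H : Type w) [NormedAddCommGroup H] [InnerProductSpace ℂ H] [CompleteSpace H]
      (π : CovariantRep α H), ‖π.integrated x‖ ≤ C := by
  induction x using TwistedConv.induction with
  | zero => exact ⟨0, fun H _ _ _ π => by simp⟩
  | add x y hx hy =>
    obtain ⟨C, hC⟩ := hx
    obtain ⟨D, hD⟩ := hy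
    refine ⟨C + D, fun H _ _ _ π => ?_⟩
    rw [map_add]
    exact (norm_add_le _ _).trans (add_le_add (hC H π) (hD H π))
  | single g a =>
    refine ⟨‖a‖, fun H _ _ _ π => ?_⟩
    rw [integrated_single, CStarRing.norm_mul_coe_unitary]
    exact NonUnitalStarAlgHom.norm_apply_le π.σ a

end CovariantRep

namespace TwistedConv

variable {α : G →* (A ≃⋆ₐ[ℂ] A)}

/-- The set of the norms of `f` in all covariant representations. -/
def repNorms (f : TwistedConv α) : Set ℝ :=
  {r | ∃ (H : Type (max u v)) (_ : NormedAddCommGroup H) (_ : InnerProductSpace ℂ H)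
    (_ : CompleteSpace H) (π : CovariantRep α H), r = ‖π.integrated f‖}

/-- The universal norm on `C_c(G, A)`: the supremum of the norms in all covariant
representations, that is, the norm in the universal representation. -/
instance : Norm (TwistedConv α) where
  norm f := sSup (repNorms f)

theorem norm_def (f : TwistedConv α) : ‖f‖ = sSup (repNorms f) := rfl

theorem bddAbove_repNorms (f : TwistedConv α) : BddAbove (repNorms f) := by
  obtain ⟨C, hC⟩ := CovariantRep.exists_norm_integrated_le f
  exact ⟨C, by rintro _ ⟨H, _, _, _, π, rfl⟩; exact hC H π⟩

theorem norm_nonneg' (f : TwistedConv α) : 0 ≤ ‖f‖ :=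
  Real.sSup_nonneg (by rintro _ ⟨H, _, _, _, π, rfl⟩; exact norm_nonneg _)

theorem norm_integrated_le {H : Type (max u v)} [NormedAddCommGroup H] [InnerProductSpace ℂ H]
    [CompleteSpace H] (π : CovariantRep α H) (f : TwistedConv α) : ‖π.integrated f‖ ≤ ‖f‖ :=
  le_csSup (bddAbove_repNorms f) ⟨H, _, _, _, π, rfl⟩

theorem norm_le {f : TwistedConv α} {C : ℝ} (hC : 0 ≤ C)
    (h : ∀ (H : Type (max u v)) [NormedAddCommGroup H] [InnerProductSpace ℂ H] [CompleteSpace H]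
      (π : CovariantRep α H), ‖π.integrated f‖ ≤ C) : ‖f‖ ≤ C :=
  Real.sSup_le (by rintro _ ⟨H, _, _, _, π, rfl⟩; exact h H π) hC

theorem norm_mul_le' (x y : TwistedConv α) : ‖x * y‖ ≤ ‖x‖ * ‖y‖ :=
  norm_le (mul_nonneg (norm_nonneg' x) (norm_nonneg' y)) fun H _ _ _ π => by
    rw [map_mul]
    exact (norm_mul_le _ _).trans (mul_le_mul (norm_integrated_le π x) (norm_integrated_le π y)
      (norm_nonneg _) (norm_nonneg' x))

instance : SeminormedAddCommGroup (TwistedConv α) :=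
  AddGroupSeminorm.toSeminormedAddCommGroup
    { toFun := fun f => ‖f‖
      map_zero' := le_antisymm (norm_le le_rfl fun H _ _ _ π => by simp) (norm_nonneg' 0)
      add_le' := fun x y => norm_le (add_nonneg (norm_nonneg' x) (norm_nonneg' y))
        fun H _ _ _ π => by
          rw [map_add]
          exact (norm_add_le _ _).trans
            (add_le_add (norm_integrated_le π x) (norm_integrated_le π y))
      neg' := fun x => by simp only [norm_def, repNorms, map_neg, norm_neg] }

instance : SeminormedRing (TwistedConv α) where
  __ := (inferInstance : SeminormedAddCommGroup (TwistedConv α))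
  __ := (inferInstance : Ring (TwistedConv α))
  norm_mul_le := norm_mul_le'

instance : NormedAlgebra ℂ (TwistedConv α) where
  norm_smul_le c x := norm_le (mul_nonneg (norm_nonneg c) (norm_nonneg x)) fun H _ _ _ π => by
    rw [map_smul, norm_smul]
    exact mul_le_mul_of_nonneg_left (norm_integrated_le π x) (norm_nonneg c)

theorem norm_star' (x : TwistedConv α) : ‖star x‖ = ‖x‖ := by
  simp only [norm_def, repNorms, map_star, norm_star]

theorem norm_mul_self_le' (x : TwistedConv α) : ‖x‖ * ‖x‖ ≤ ‖star x * x‖ := by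
  have h : ‖x‖ ≤ √‖star x * x‖ := norm_le (Real.sqrt_nonneg _) fun H _ _ _ π => by
    refine Real.le_sqrt_of_sq_le ?_
    rw [sq, ← CStarRing.norm_star_mul_self, ← map_star, ← map_mul]
    exact norm_integrated_le π _
  calc ‖x‖ * ‖x‖ ≤ √‖star x * x‖ * √‖star x * x‖ :=
        mul_self_le_mul_self (norm_nonneg x) h
    _ = ‖star x * x‖ := Real.mul_self_sqrt (norm_nonneg _)

end TwistedConv

/-- The *(full) crossed product* `A ⋊_α G`: the completion of the ⋆-algebra `C_c(G, A)` for the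
universal norm. -/
def FullCrossedProduct (α : G →* (A ≃⋆ₐ[ℂ] A)) : Type (max u v) :=
  UniformSpace.Completion (TwistedConv α)

namespace FullCrossedProduct

open UniformSpace

variable (α : G →* (A ≃⋆ₐ[ℂ] A))

instance : NormedRing (FullCrossedProduct α) :=
  inferInstanceAs (NormedRing (Completion (TwistedConv α)))

instance : CompleteSpace (FullCrossedProduct α) :=
  inferInstanceAs (CompleteSpace (Completion (TwistedConv α)))

instance : Algebra ℂ (FullCrossedProduct α) :=
  inferInstanceAs (Algebra ℂ (Completion (TwistedConv α)))

instance : NormedAlgebra ℂ (FullCrossedProduct α) where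
  norm_smul_le := norm_smul_le (α := ℂ) (β := Completion (TwistedConv α))

variable {α}

/-- The canonical map from `C_c(G, A)` to the crossed product. -/
def of (x : TwistedConv α) : FullCrossedProduct α := (x : Completion (TwistedConv α))

theorem of_add (x y : TwistedConv α) : of (x + y) = of x + of y := Completion.coe_add x y

theorem of_mul (x y : TwistedConv α) : of (x * y) = of x * of y := Completion.coe_mul x y

theorem of_smul (c : ℂ) (x : TwistedConv α) : of (c • x) = c • of x := Completion.coe_smul c x

theorem norm_of (x : TwistedConv α) : ‖of x‖ = ‖x‖ := Completion.norm_coe x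

theorem denseRange_of : DenseRange (of : TwistedConv α → FullCrossedProduct α) :=
  Completion.denseRange_coe

/-- The involution is the continuous extension of that of `C_c(G, A)`. -/
instance : Star (FullCrossedProduct α) where
  star := Completion.map (star : TwistedConv α → TwistedConv α)

theorem isometry_star : Isometry (star : TwistedConv α → TwistedConv α) :=
  AddMonoidHomClass.isometry_of_norm (starAddEquiv : TwistedConv α ≃+ TwistedConv α)
    TwistedConv.norm_star'

theorem star_of (x : TwistedConv α) : star (of x) = of (star x) :=
  Completion.map_coe isometry_star.uniformContinuous x

theorem continuous_star' :
    Continuous (star : FullCrossedProduct α → FullCrossedProduct α) :=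
  Completion.continuous_map

instance : StarRing (FullCrossedProduct α) where
  star_involutive x := by
    refine denseRange_of.induction_on x
      (isClosed_eq (continuous_star'.comp continuous_star') continuous_id) fun a => ?_
    simp only [star_of, star_star]
  star_add x y := by
    refine denseRange_of.induction_on₂ (p := fun x y => star (x + y) = star x + star y)
      (isClosed_eq (continuous_star'.comp continuous_add)
        ((continuous_star'.comp continuous_fst).add (continuous_star'.comp continuous_snd)))
      (fun a b => ?_) x y
    simp only [star_of, ← of_add, star_add]
  star_mul x y := by
    refine denseRange_of.induction_on₂ (p := fun x y => star (x * y) = star y * star x)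
      (isClosed_eq (continuous_star'.comp continuous_mul)
        ((continuous_star'.comp continuous_snd).mul (continuous_star'.comp continuous_fst)))
      (fun a b => ?_) x y
    simp only [star_of, ← of_mul, star_mul]

instance : StarModule ℂ (FullCrossedProduct α) where
  star_smul c x := by
    refine denseRange_of.induction_on x
      (isClosed_eq (continuous_star'.comp (continuous_const_smul c))
        (continuous_star'.const_smul (star c))) fun a => ?_
    simp only [star_of, ← of_smul, star_smul]

instance : CStarRing (FullCrossedProduct α) where
  norm_mul_self_le x := by
    refine denseRange_of.induction_on x
      (isClosed_le (continuous_norm.mul continuous_norm)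
        (continuous_norm.comp (continuous_star'.mul continuous_id))) fun a => ?_
    simp only [star_of, ← of_mul, norm_of]
    exact TwistedConv.norm_mul_self_le' a

instance : CStarAlgebra (FullCrossedProduct α) where

end FullCrossedProduct

end CrossedProduct

end

/-! Let `ρ` be a faithful quasidiagonal representation of `A` on `H`. The crossed product is
represented on `ℓ²(G, H)` by the regular covariant representation, and the projections come from the
finite quotients `G ⧸ L n`.

Amenability makes this representation isometric. Compressed to a finite set `E`, it becomes a matrix
over `A`, whose norm is attained in every faithful representation of `A` and cannot grow in any
other. Re-summing the matrix inside a covariant representation `π` multiplies the term at `g` by the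
number of `s ∈ E` with `g⁻¹ s ∈ E`. For `E = (F n)⁻¹`, after division by `|E|`, these factors tend
to `1`, so the regular norm dominates that of `π` (`IsFolnerSequence.norm_integrated_le`).

For the projections, smooth the indicator function of the tile: let `φ(s)` be the proportion of `f ∈
F` with `f s ∈ K`. Every translate `f⁻¹ K` meets each coset of `L` exactly once, so `φ` sums to `1`
over each coset and `(W h)(s) = φ(s)^(1/2) h(sL)` is an isometry from `H^(G/L)`. The Følner
condition makes `W` almost intertwine the translations of `G` and of `G ⧸ L`. Near-invariance under
`L ∩ K K⁻¹ F` makes it almost intertwine `a` with the diagonal operator with entries `ρ(α(x⁻¹) a)`,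
`x ∈ K`.

Put `Q = W (1 ⊗ p) W*`. Coset translations commute with `1 ⊗ p`, and the diagonal operator almost
does once `p` almost commutes with its finitely many entries, which quasidiagonality of `A` permits.
Finally `F n ⊆ K n` forces `φ(g) → 1` for every `g`, whence `Q → 1` strongly. -/

noncomputable section

/-! ### Operators on Hilbert space valued `ℓ²` spaces -/

section SquareSummable

variable {ι : Type*} {H : Type*} [NormedAddCommGroup H]

theorem memℓp_two_iff_summable_sq {f : ι → H} : Memℓp f 2 ↔ Summable fun i => ‖f i‖ ^ 2 := by
  rw [memℓp_gen_iff (by norm_num)]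
  simp

theorem lp.hasSum_norm_sq (f : lp (fun _ : ι => H) 2) :
    HasSum (fun i => ‖f i‖ ^ 2) (‖f‖ ^ 2) := by
  simpa using lp.hasSum_norm (p := 2) (by norm_num) f

theorem lp.norm_le_of_hasSum_sq_le {f : lp (fun _ : ι => H) 2} {g : ι → ℝ} {C : ℝ}
    (hC : 0 ≤ C) (hg : HasSum g (C ^ 2)) (h : ∀ i, ‖f i‖ ^ 2 ≤ g i) : ‖f‖ ≤ C :=
  (sq_le_sq₀ (norm_nonneg f) hC).1 (hasSum_le h (lp.hasSum_norm_sq f) hg)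

variable [InnerProductSpace ℂ H]

/-- The diagonal operator on `ℓ²(ι, H)` with a bounded family of operators on the diagonal. -/
def lp.diagonalCLM (T : ι → H →L[ℂ] H) (C : ℝ) (hC : 0 ≤ C) (hT : ∀ i, ‖T i‖ ≤ C) :
    lp (fun _ : ι => H) 2 →L[ℂ] lp (fun _ : ι => H) 2 :=
  have key (ξ : lp (fun _ : ι => H) 2) (i : ι) : ‖T i (ξ i)‖ ^ 2 ≤ C ^ 2 * ‖ξ i‖ ^ 2 := by
    rw [← mul_pow]
    exact pow_le_pow_left₀ (norm_nonneg _) ((T i).le_of_opNorm_le (hT i) _) 2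
  LinearMap.mkContinuous
    { toFun := fun ξ => ⟨fun i => T i (ξ i), memℓp_two_iff_summable_sq.2 <|
        Summable.of_nonneg_of_le (fun _ => sq_nonneg _) (key ξ)
          ((lp.hasSum_norm_sq ξ).summable.mul_left _)⟩
      map_add' := fun ξ η => lp.ext (funext fun i => map_add (T i) _ _)
      map_smul' := fun c ξ => lp.ext (funext fun i => map_smul (T i) _ _) }
    C fun ξ => lp.norm_le_of_hasSum_sq_le (by positivity)
      (by rw [mul_pow]; exact (lp.hasSum_norm_sq ξ).mul_left _) (key ξ)

@[simp]
theorem lp.diagonalCLM_apply (T : ι → H →L[ℂ] H) (C : ℝ) (hC : 0 ≤ C) (hT : ∀ i, ‖T i‖ ≤ C)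
    (ξ : lp (fun _ : ι => H) 2) (i : ι) : lp.diagonalCLM T C hC hT ξ i = T i (ξ i) := rfl

variable (H) in
/-- The isometric linear equivalence of `ℓ²(ι, H)` induced by a permutation of `ι`. -/
def lp.permLinearIsometryEquiv (e : Equiv.Perm ι) :
    lp (fun _ : ι => H) 2 ≃ₗᵢ[ℂ] lp (fun _ : ι => H) 2 where
  toFun ξ := ⟨fun i => ξ (e.symm i), memℓp_two_iff_summable_sq.2 <|
    (e.symm.summable_iff (f := fun i => ‖ξ i‖ ^ 2)).2 (lp.hasSum_norm_sq ξ).summable⟩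
  invFun ξ := ⟨fun i => ξ (e i), memℓp_two_iff_summable_sq.2 <|
    (e.summable_iff (f := fun i => ‖ξ i‖ ^ 2)).2 (lp.hasSum_norm_sq ξ).summable⟩
  map_add' ξ η := rfl
  map_smul' c ξ := rfl
  left_inv ξ := lp.ext (funext fun i => congrArg ξ (e.symm_apply_apply i))
  right_inv ξ := lp.ext (funext fun i => congrArg ξ (e.apply_symm_apply i))
  norm_map' ξ := by
    rw [← sq_eq_sq₀ (norm_nonneg _) (norm_nonneg _)]
    exact (lp.hasSum_norm_sq _).unique
      ((e.symm.hasSum_iff (f := fun i => ‖ξ i‖ ^ 2)).2 (lp.hasSum_norm_sq ξ))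

theorem lp.dense_span_single [DecidableEq ι] :
    Dense (Submodule.span ℂ (⋃ i : ι, Set.range fun h : H => lp.single 2 i h) :
      Set (lp (fun _ : ι => H) 2)) := fun ξ => by
  refine mem_closure_of_tendsto (lp.hasSum_single (by norm_num) ξ) (Eventually.of_forall fun s => ?_)
  exact Submodule.sum_mem _ fun i _ =>
    Submodule.subset_span (Set.mem_iUnion.2 ⟨i, ξ i, rfl⟩)

instance lp.separableSpace_two [Countable ι] [TopologicalSpace.SeparableSpace H] :
    TopologicalSpace.SeparableSpace (lp (fun _ : ι => H) 2) := by
  classical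
  rw [← TopologicalSpace.isSeparable_univ_iff, ← lp.dense_span_single.closure_eq]
  refine TopologicalSpace.IsSeparable.closure (TopologicalSpace.IsSeparable.span ?_)
  exact TopologicalSpace.IsSeparable.iUnion fun i =>
    TopologicalSpace.isSeparable_range (lp.singleContinuousLinearMap ℂ (fun _ : ι => H) 2 i).continuous

end SquareSummable

/-! ### The regular representation -/

section RegularRep

variable {A : Type u} [CStarAlgebra A] {G : Type v} [Group G] {H : Type w}
  [NormedAddCommGroup H] [InnerProductSpace ℂ H] [CompleteSpace H]

/-- The representation `(σ̃(a)ξ)(s) = σ(α(s⁻¹)a) ξ(s)` of `A` on `ℓ²(G, H)`. -/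
def regularAlgHom (α : G →* (A ≃⋆ₐ[ℂ] A)) (σ : A →⋆ₐ[ℂ] (H →L[ℂ] H)) :
    A →⋆ₐ[ℂ] (lp (fun _ : G => H) 2 →L[ℂ] lp (fun _ : G => H) 2) where
  toFun a := lp.diagonalCLM (fun s => σ (α s⁻¹ a)) ‖a‖ (norm_nonneg a) fun s =>
    (NonUnitalStarAlgHom.norm_apply_le σ _).trans (NonUnitalStarAlgHom.norm_apply_le (α s⁻¹) a)
  map_one' := by ext ξ s; simp
  map_mul' a b := by ext ξ s; simp
  map_zero' := by ext ξ s; simp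
  map_add' a b := by ext ξ s; simp
  commutes' c := by ext ξ s; simp [Algebra.algebraMap_eq_smul_one]
  map_star' a := by
    rw [ContinuousLinearMap.star_eq_adjoint, ContinuousLinearMap.eq_adjoint_iff]
    intro ξ η
    simp only [lp.inner_eq_tsum, lp.diagonalCLM_apply, map_star,
      ContinuousLinearMap.star_eq_adjoint, ContinuousLinearMap.adjoint_inner_left]

@[simp]
theorem regularAlgHom_apply (α : G →* (A ≃⋆ₐ[ℂ] A)) (σ : A →⋆ₐ[ℂ] (H →L[ℂ] H)) (a : A)
    (ξ : lp (fun _ : G => H) 2) (s : G) : regularAlgHom α σ a ξ s = σ (α s⁻¹ a) (ξ s) := rfl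

variable (G H) in
/-- The left translations on `ℓ²(G, H)`. -/
def leftTranslation : G →* unitary (lp (fun _ : G => H) 2 →L[ℂ] lp (fun _ : G => H) 2) :=
  Unitary.linearIsometryEquiv.symm.toMonoidHom.comp
    { toFun := fun g => lp.permLinearIsometryEquiv H (Equiv.mulLeft g)
      map_one' := by ext ξ s; exact congrArg ξ (by simp [Equiv.symm_apply_eq])
      map_mul' := fun g h => by
        ext ξ s
        exact congrArg ξ (by simp [← Equiv.Perm.inv_def]) }

@[simp]
theorem leftTranslation_apply (g : G) (ξ : lp (fun _ : G => H) 2) (s : G) :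
    (leftTranslation G H g : lp (fun _ : G => H) 2 →L[ℂ] lp (fun _ : G => H) 2) ξ s
      = ξ (g⁻¹ * s) := rfl

/-- The regular covariant representation on `ℓ²(G, H)` associated with a representation of `A`
on `H`. -/
def regularRep (α : G →* (A ≃⋆ₐ[ℂ] A)) (σ : A →⋆ₐ[ℂ] (H →L[ℂ] H)) :
    CovariantRep α (lp (fun _ : G => H) 2) where
  σ := regularAlgHom α σ
  u := leftTranslation G H
  covariant g a := by
    have h : (leftTranslation G H g : lp (fun _ : G => H) 2 →L[ℂ] lp (fun _ : G => H) 2) *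
        regularAlgHom α σ a = regularAlgHom α σ (α g a) * leftTranslation G H g := by
      ext ξ s
      simp only [mul_apply_eq_comp, leftTranslation_apply, regularAlgHom_apply,
        TwistedConv.action_mul_apply, mul_inv_rev, inv_inv]
    rw [h, mul_assoc, Unitary.mul_star_self_of_mem (leftTranslation G H g).2, mul_one]

theorem regularRep_integrated_single_apply (α : G →* (A ≃⋆ₐ[ℂ] A)) (σ : A →⋆ₐ[ℂ] (H →L[ℂ] H))
    (g : G) (a : A) (ξ : lp (fun _ : G => H) 2) (s : G) :
    (regularRep α σ).integrated (TwistedConv.single α g a) ξ s = σ (α s⁻¹ a) (ξ (g⁻¹ * s)) := by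
  rw [CovariantRep.integrated_single]
  rfl

end RegularRep

end

noncomputable section

/-! ### Følner sequences -/

section Folner

variable {G : Type v} [Group G] {F : ℕ → Finset G}

theorem IsFolnerSequence.card_pos (hF : IsFolnerSequence F) (n : ℕ) : 0 < (F n).card :=
  Finset.card_pos.2 ⟨1, hF.mono (Nat.zero_le n) hF.one_mem⟩

-- Right translation by `g` injects the exceptional `x` into `F n ∆ F n g`. This form of the Følner
-- condition serves both the norm comparison and the convergence of the tile weights.
open scoped Classical in
theorem IsFolnerSequence.tendsto_card_filter_mul_mem (hF : IsFolnerSequence F) (g : G) :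
    Tendsto (fun n => (((F n).filter fun x => x * g ∈ F n).card : ℝ) / ((F n).card : ℝ))
      atTop (𝓝 1) := by
  have h := (hF.tendsto_symmDiff g).const_sub 1
  rw [sub_zero] at h
  refine tendsto_of_tendsto_of_tendsto_of_le_of_le h tendsto_const_nhds (fun n => ?_) fun n => ?_
  · have hpos : (0 : ℝ) < (F n).card := by exact_mod_cast hF.card_pos n
    rw [sub_le_iff_le_add, ← add_div, le_div_iff₀ hpos, one_mul]
    have h1 : ((F n).filter fun x => ¬ x * g ∈ F n).card ≤
        (F n ∆ (F n).image (fun x => x * g)).card := by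
      refine Finset.card_le_card_of_injOn (fun x => x * g) (fun x hx => ?_)
        (fun x _ y _ h => mul_right_cancel h)
      have hx' := Finset.mem_filter.1 hx
      exact Finset.mem_symmDiff.2 (Or.inr ⟨Finset.mem_image_of_mem _ hx'.1, hx'.2⟩)
    have h2 := Finset.card_filter_add_card_filter_not (s := F n) fun x => x * g ∈ F n
    rw [← h2, Nat.cast_add]
    exact add_le_add_right (Nat.cast_le.2 h1) _
  · exact div_le_one_of_le₀ (Nat.cast_le.2 (Finset.card_filter_le _ _)) (Nat.cast_nonneg _)

end Folner

/-! ### Matrices over a C⋆-algebra acting on a Hilbert space -/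

section MatrixRep

variable {A : Type u} [CStarAlgebra A] {E : Type*} [Fintype E]
  {H : Type w} [NormedAddCommGroup H] [InnerProductSpace ℂ H]

/-- The operator on `H^E` given by a matrix of operators on `H`. -/
def operatorMatrixCLM (M : E → E → H →L[ℂ] H) :
    PiLp 2 (fun _ : E => H) →L[ℂ] PiLp 2 (fun _ : E => H) :=
  ((PiLp.continuousLinearEquiv 2 ℂ fun _ : E => H).symm : (E → H) →L[ℂ] PiLp 2 fun _ : E => H) ∘L
    ContinuousLinearMap.pi fun i => ∑ j, M i j ∘L PiLp.proj 2 (fun _ : E => H) j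

theorem operatorMatrixCLM_apply (M : E → E → H →L[ℂ] H) (ξ : PiLp 2 (fun _ : E => H)) (i : E) :
    operatorMatrixCLM M ξ i = ∑ j, M i j (ξ j) := by
  simp [operatorMatrixCLM]

variable [CompleteSpace H] [DecidableEq E]

variable (E) in
/-- The representation of the matrices over `A` on `H^E` induced by a representation of `A`
on `H`. -/
def matrixAlgHom (σ : A →⋆ₐ[ℂ] (H →L[ℂ] H)) :
    CStarMatrix E E A →⋆ₐ[ℂ] (PiLp 2 (fun _ : E => H) →L[ℂ] PiLp 2 (fun _ : E => H)) where
  toFun M := operatorMatrixCLM fun i j => σ (M i j)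
  map_one' := by
    ext ξ i
    simp [operatorMatrixCLM_apply, CStarMatrix.one_apply, apply_ite σ]
    rw [Finset.sum_eq_single i (fun j _ hj => by simp [Ne.symm hj]) (by simp)]
    simp
  map_mul' M N := by
    ext ξ i
    simp only [operatorMatrixCLM_apply, CStarMatrix.mul_apply, mul_apply_eq_comp, map_sum, map_mul,
      sum_apply]
    exact Finset.sum_comm
  map_zero' := by ext ξ i; simp [operatorMatrixCLM_apply]
  map_add' M N := by ext ξ i; simp [operatorMatrixCLM_apply, Finset.sum_add_distrib]
  commutes' c := by
    ext ξ i
    simp [operatorMatrixCLM_apply, CStarMatrix.algebraMap_apply, apply_ite σ,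
      Algebra.algebraMap_eq_smul_one]
    rw [Finset.sum_eq_single i (fun j _ hj => by simp [Ne.symm hj]) (by simp)]
    simp
  map_star' M := by
    rw [ContinuousLinearMap.star_eq_adjoint, ContinuousLinearMap.eq_adjoint_iff]
    intro ξ η
    simp only [PiLp.inner_apply, operatorMatrixCLM_apply, CStarMatrix.star_apply, map_star,
      ContinuousLinearMap.star_eq_adjoint, sum_inner, inner_sum,
      ContinuousLinearMap.adjoint_inner_left]
    exact Finset.sum_comm

@[simp]
theorem matrixAlgHom_apply (σ : A →⋆ₐ[ℂ] (H →L[ℂ] H)) (M : CStarMatrix E E A)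
    (ξ : PiLp 2 (fun _ : E => H)) (i : E) :
    matrixAlgHom E σ M ξ i = ∑ j, σ (M i j) (ξ j) :=
  operatorMatrixCLM_apply _ ξ i

theorem matrixAlgHom_injective {σ : A →⋆ₐ[ℂ] (H →L[ℂ] H)} (hσ : Function.Injective σ) :
    Function.Injective (matrixAlgHom E σ) := fun M N h => by
  ext i j
  refine hσ (ContinuousLinearMap.ext fun x => ?_)
  have key (M : CStarMatrix E E A) : matrixAlgHom E σ M (PiLp.single 2 j x) i = σ (M i j) x := by
    rw [matrixAlgHom_apply, Finset.sum_eq_single j (fun k _ hk => by simp [hk]) (by simp)]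
    simp
  rw [← key, ← key, h]

/-- An injective ⋆-homomorphism of the C⋆-algebra of matrices over `A` is isometric, and every other
one is contractive. -/
theorem norm_matrixAlgHom_le {σ : A →⋆ₐ[ℂ] (H →L[ℂ] H)} (hσ : Function.Injective σ)
    {H' : Type*} [NormedAddCommGroup H'] [InnerProductSpace ℂ H'] [CompleteSpace H']
    (σ' : A →⋆ₐ[ℂ] (H' →L[ℂ] H')) (M : CStarMatrix E E A) :
    ‖matrixAlgHom E σ' M‖ ≤ ‖matrixAlgHom E σ M‖ := by
  -- The C⋆-norm on `CStarMatrix E E A` requires an order on `A`.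
  let := CStarAlgebra.spectralOrder A
  let := CStarAlgebra.spectralOrderedRing A
  rw [NonUnitalStarAlgHom.norm_map (matrixAlgHom E σ) (matrixAlgHom_injective hσ)]
  exact NonUnitalStarAlgHom.norm_apply_le (matrixAlgHom E σ') M

end MatrixRep

/-! ### The universal norm for actions of amenable groups -/

section Amenable

variable {A : Type u} [CStarAlgebra A] {G : Type v} [Group G] {α : G →* (A ≃⋆ₐ[ℂ] A)}
  {H : Type w} [NormedAddCommGroup H] [InnerProductSpace ℂ H] [CompleteSpace H]
  {H' : Type*} [NormedAddCommGroup H'] [InnerProductSpace ℂ H'] [CompleteSpace H']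

open scoped Classical in
/-- The compression to `E` of the left regular representation, as a matrix over `A`. -/
def truncation (E : Finset G) : TwistedConv α →+ CStarMatrix E E A :=
  TwistedConv.liftAdd α fun g =>
    { toFun := fun a => CStarMatrix.ofMatrix fun s t => if (s : G) = g * t then α (s : G)⁻¹ a else 0
      map_zero' := by ext s t; change (if _ then _ else _) = (0 : A); simp
      map_add' := fun a b => by
        ext s t
        change (if _ then _ else _) = (if _ then _ else (0 : A)) + (if _ then _ else _)
        split_ifs <;> simp }

open scoped Classical in
theorem truncation_single_apply (E : Finset G) (g : G) (a : A) (s t : E) :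
    truncation E (TwistedConv.single α g a) s t
      = if (s : G) = g * t then α (s : G)⁻¹ a else 0 := by
  rw [truncation, TwistedConv.liftAdd_single]
  rfl

-- The matrix equals `R π(f) J`, with `π` the regular representation, `R` restriction to `E` and `J`
-- extension by zero, both contractions.
open scoped Classical in
theorem norm_matrixAlgHom_truncation_le (σ : A →⋆ₐ[ℂ] (H →L[ℂ] H)) (E : Finset G)
    (f : TwistedConv α) :
    ‖matrixAlgHom E σ (truncation E f)‖ ≤ ‖(regularRep α σ).integrated f‖ := by
  let R : lp (fun _ : G => H) 2 →L[ℂ] PiLp 2 (fun _ : E => H) :=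
    ((PiLp.continuousLinearEquiv 2 ℂ fun _ : E => H).symm : (E → H) →L[ℂ] PiLp 2 fun _ : E => H) ∘L
      ContinuousLinearMap.pi fun s => lp.evalCLM ℂ (fun _ : G => H) 2 (s : G)
  let J : PiLp 2 (fun _ : E => H) →L[ℂ] lp (fun _ : G => H) 2 :=
    ∑ t : E, lp.singleContinuousLinearMap ℂ (fun _ : G => H) 2 (t : G) ∘L
      PiLp.proj 2 (fun _ : E => H) t
  have hR (ξ) (s : E) : R ξ s = ξ (s : G) := rfl
  have hJ (ξ) (s : G) : J ξ s = ∑ t : E, if s = t then ξ t else 0 := by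
    simp only [J, sum_apply, ContinuousLinearMap.comp_apply, lp.singleContinuousLinearMap_apply,
      lp.coeFn_sum, Finset.sum_apply, lp.single_apply, Pi.single_apply, PiLp.proj_apply]
  have hR1 (ξ) : ‖R ξ‖ ≤ ‖ξ‖ := by
    rw [← sq_le_sq₀ (norm_nonneg _) (norm_nonneg _), PiLp.norm_sq_eq_of_L2]
    simp only [hR]
    rw [Finset.sum_coe_sort E fun s => ‖ξ s‖ ^ 2]
    exact sum_le_hasSum E (fun _ _ => sq_nonneg _) (lp.hasSum_norm_sq ξ)
  have hJ1 (ξ) : ‖J ξ‖ ≤ ‖ξ‖ := by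
    rw [← sq_le_sq₀ (norm_nonneg _) (norm_nonneg _), PiLp.norm_sq_eq_of_L2]
    refine le_of_eq ((lp.hasSum_norm_sq (J ξ)).unique ?_)
    refine (Function.Injective.hasSum_iff (f := fun s => ‖J ξ s‖ ^ 2)
      (Subtype.val_injective (p := (· ∈ E))) fun s hs => ?_).1 ?_
    · rw [hJ, Finset.sum_eq_zero fun t _ => if_neg fun h => hs ⟨t, h.symm⟩]
      simp
    · convert hasSum_fintype fun t : E => ‖ξ t‖ ^ 2 with t
      simp [hJ]
  have key : matrixAlgHom E σ (truncation E f) = R ∘L (regularRep α σ).integrated f ∘L J := by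
    induction f using TwistedConv.induction with
    | zero => simp
    | add x y hx hy => simp only [map_add, hx, hy, ContinuousLinearMap.add_comp, ContinuousLinearMap.comp_add]
    | single g a =>
      ext ξ s
      simp only [matrixAlgHom_apply, truncation_single_apply, ContinuousLinearMap.comp_apply, hR,
        regularRep_integrated_single_apply, hJ, map_sum]
      refine Finset.sum_congr rfl fun t _ => ?_
      simp only [inv_mul_eq_iff_eq_mul]
      split_ifs <;> simp
  rw [key]
  refine ContinuousLinearMap.opNorm_le_bound _ (norm_nonneg _) fun ξ => ?_
  exact (hR1 _).trans ((((regularRep α σ).integrated f).le_opNorm _).trans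
    (mul_le_mul_of_nonneg_left (hJ1 ξ) (norm_nonneg _)))

/-- The sum `∑ s t, u(s) σ(M s t) u(t)⁻¹` over the entries of the truncation `M` of `f` to `E`. -/
def truncationSum (π : CovariantRep α H') (E : Finset G) : TwistedConv α →+ (H' →L[ℂ] H') where
  toFun f := ∑ s : E, ∑ t : E,
    (π.u (s : G) : H' →L[ℂ] H') * π.σ (truncation E f s t) * (π.u (t : G)⁻¹ : H' →L[ℂ] H')
  map_zero' := by simp
  map_add' f f' := by
    simp [CStarMatrix.add_apply, mul_add, add_mul, Finset.sum_add_distrib]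

-- By covariance `u(s) σ(α(s⁻¹) a) u(t)⁻¹ = σ(a) u(s t⁻¹)`, which is `σ(a) u(g)` whenever `s = g t`.
-- All nonzero terms thus coincide, and only their number matters.
open scoped Classical in
theorem truncationSum_single (π : CovariantRep α H') (E : Finset G) (g : G) (a : A) :
    truncationSum π E (TwistedConv.single α g a)
      = (E.filter fun s => g⁻¹ * s ∈ E).card • π.integrated (TwistedConv.single α g a) := by
  have key (s t : E) : (π.u (s : G) : H' →L[ℂ] H') *
      π.σ (truncation E (TwistedConv.single α g a) s t) * (π.u (t : G)⁻¹ : H' →L[ℂ] H')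
      = if (t : G) = g⁻¹ * s then π.integrated (TwistedConv.single α g a) else 0 := by
    rw [truncation_single_apply, eq_inv_mul_iff_mul_eq]
    split_ifs with h1 h2 h2
    · rw [π.u_mul_σ, TwistedConv.action_mul_apply, mul_inv_cancel, TwistedConv.action_one_apply,
        CovariantRep.integrated_single, mul_assoc, ← Submonoid.coe_mul, ← map_mul, h1,
        mul_inv_cancel_right]
    · exact absurd h1.symm h2
    · exact absurd h2.symm h1
    · simp
  have hsum (s : E) : (∑ t : E, if (t : G) = g⁻¹ * s then
      π.integrated (TwistedConv.single α g a) else 0)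
      = if g⁻¹ * (s : G) ∈ E then π.integrated (TwistedConv.single α g a) else 0 := by
    rw [Finset.sum_coe_sort E fun t => if t = g⁻¹ * (s : G) then
      π.integrated (TwistedConv.single α g a) else 0, Finset.sum_ite_eq']
  change ∑ s : E, ∑ t : E, _ = _
  simp only [key, hsum]
  rw [Finset.sum_coe_sort E fun s => if g⁻¹ * s ∈ E then
      π.integrated (TwistedConv.single α g a) else 0, ← Finset.sum_filter, Finset.sum_const]

/-- Applied to `h`, the sum is the matrix acting on the column `(u(t)⁻¹ h)`, followed by the row of
unitaries `u(s)`. Column and row each contribute a factor `|E|^(1/2)`, the second by Cauchy–Schwarz.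
-/
theorem norm_truncationSum_le (π : CovariantRep α H') {σ : A →⋆ₐ[ℂ] (H →L[ℂ] H)}
    (hσ : Function.Injective σ) (E : Finset G) (f : TwistedConv α) :
    ‖truncationSum π E f‖ ≤ E.card * ‖(regularRep α σ).integrated f‖ := by
  classical
  refine ContinuousLinearMap.opNorm_le_bound _ (by positivity) fun h => ?_
  let ξ : PiLp 2 (fun _ : E => H') := WithLp.toLp 2 fun t => (π.u (t : G)⁻¹ : H' →L[ℂ] H') h
  have hξ : ‖ξ‖ ^ 2 = E.card * ‖h‖ ^ 2 := by
    simp [PiLp.norm_sq_eq_of_L2, ξ, Unitary.norm_map]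
  let η := matrixAlgHom E π.σ (truncation E f) ξ
  have hη : truncationSum π E f h = ∑ s : E, (π.u (s : G) : H' →L[ℂ] H') (η s) := by
    simp [truncationSum, η, ξ]
  have h1 : ‖η‖ ≤ ‖(regularRep α σ).integrated f‖ * ‖ξ‖ :=
    ContinuousLinearMap.le_of_opNorm_le _ ((norm_matrixAlgHom_le hσ π.σ _).trans
      (norm_matrixAlgHom_truncation_le σ E f)) ξ
  have h2 : ‖truncationSum π E f h‖ ≤ ∑ s : E, ‖η s‖ := by
    rw [hη]
    refine (norm_sum_le _ _).trans (Finset.sum_le_sum fun s _ => ?_)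
    rw [Unitary.norm_map]
  have h3 : (∑ s : E, ‖η s‖) ^ 2 ≤ E.card * ‖η‖ ^ 2 := by
    rw [PiLp.norm_sq_eq_of_L2]
    simpa using sq_sum_le_card_mul_sum_sq (s := (Finset.univ : Finset E)) (f := fun s => ‖η s‖)
  rw [← sq_le_sq₀ (norm_nonneg _) (by positivity)]
  calc ‖truncationSum π E f h‖ ^ 2 ≤ (∑ s : E, ‖η s‖) ^ 2 := by gcongr
    _ ≤ E.card * ‖η‖ ^ 2 := h3
    _ ≤ E.card * (‖(regularRep α σ).integrated f‖ * ‖ξ‖) ^ 2 := by gcongr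
    _ = (E.card * ‖(regularRep α σ).integrated f‖ * ‖h‖) ^ 2 := by rw [mul_pow, hξ]; ring

-- The inverse sets appear because the count in `truncationSum_single` concerns left translation by
-- `g⁻¹`, whereas `F` is asymptotically invariant on the right.
open scoped Classical in
theorem tendsto_truncationSum {F : ℕ → Finset G} (hF : IsFolnerSequence F)
    (π : CovariantRep α H') (f : TwistedConv α) :
    Tendsto (fun n => ((F n).card : ℝ)⁻¹ • truncationSum π (F n)⁻¹ f) atTop
      (𝓝 (π.integrated f)) := by
  induction f using TwistedConv.induction with
  | zero => simp
  | add x y hx hy => simpa only [map_add, smul_add] using hx.add hy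
  | single g a =>
    have hcard (n : ℕ) : ((F n)⁻¹.filter fun s => g⁻¹ * s ∈ (F n)⁻¹).card
        = ((F n).filter fun x => x * g ∈ F n).card := by
      refine Finset.card_nbij' (·⁻¹) (·⁻¹) ?_ ?_ ?_ ?_ <;> intro x <;> simp
    have := (hF.tendsto_card_filter_mul_mem g).smul_const (π.integrated (TwistedConv.single α g a))
    rw [one_smul] at this
    refine this.congr fun n => ?_
    rw [truncationSum_single, hcard, ← Nat.cast_smul_eq_nsmul ℝ, smul_smul, div_eq_inv_mul]

/-- If `G` has a Følner sequence, then every covariant representation is dominated by the regular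
representation associated with any faithful representation of `A`. -/
theorem IsFolnerSequence.norm_integrated_le {F : ℕ → Finset G} (hF : IsFolnerSequence F)
    (π : CovariantRep α H') {σ : A →⋆ₐ[ℂ] (H →L[ℂ] H)} (hσ : Function.Injective σ)
    (f : TwistedConv α) : ‖π.integrated f‖ ≤ ‖(regularRep α σ).integrated f‖ := by
  classical
  refine le_of_tendsto (tendsto_truncationSum hF π f).norm (Eventually.of_forall fun n => ?_)
  have hpos : (0 : ℝ) < (F n).card := by exact_mod_cast hF.card_pos n
  rw [norm_smul, norm_inv, Real.norm_natCast, inv_mul_le_iff₀ hpos]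
  simpa using norm_truncationSum_le π hσ (F n)⁻¹ f

end Amenable

end

noncomputable section

/-! ### Diagonal operators on finite powers of a Hilbert space -/

section Diagonal

variable {E : Type*} {H : Type w} [NormedAddCommGroup H] [InnerProductSpace ℂ H]

/-- The operator on `H^E` with the operators `T i` on the diagonal. -/
def PiLp.diagonalCLM (T : E → H →L[ℂ] H) :
    PiLp 2 (fun _ : E => H) →L[ℂ] PiLp 2 (fun _ : E => H) :=
  ((PiLp.continuousLinearEquiv 2 ℂ fun _ : E => H).symm : (E → H) →L[ℂ] PiLp 2 fun _ : E => H) ∘L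
    ContinuousLinearMap.pi fun i => T i ∘L PiLp.proj 2 (fun _ : E => H) i

@[simp]
theorem PiLp.diagonalCLM_apply (T : E → H →L[ℂ] H) (ξ : PiLp 2 (fun _ : E => H)) (i : E) :
    PiLp.diagonalCLM T ξ i = T i (ξ i) := rfl

variable [Fintype E]

theorem PiLp.norm_diagonalCLM_le {T : E → H →L[ℂ] H} {C : ℝ} (hC : 0 ≤ C)
    (hT : ∀ i, ‖T i‖ ≤ C) : ‖PiLp.diagonalCLM T‖ ≤ C := by
  refine ContinuousLinearMap.opNorm_le_bound _ hC fun ξ => ?_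
  rw [← sq_le_sq₀ (norm_nonneg _) (by positivity), mul_pow, PiLp.norm_sq_eq_of_L2,
    PiLp.norm_sq_eq_of_L2, Finset.mul_sum]
  refine Finset.sum_le_sum fun i _ => ?_
  rw [← mul_pow]
  exact pow_le_pow_left₀ (norm_nonneg _) ((T i).le_of_opNorm_le (hT i) _) 2

theorem PiLp.adjoint_diagonalCLM [CompleteSpace H] (T : E → H →L[ℂ] H) :
    ContinuousLinearMap.adjoint (PiLp.diagonalCLM T)
      = PiLp.diagonalCLM fun i => ContinuousLinearMap.adjoint (T i) := by
  refine ((ContinuousLinearMap.eq_adjoint_iff _ _).2 fun ξ η => ?_).symm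
  simp only [PiLp.inner_apply, PiLp.diagonalCLM_apply, ContinuousLinearMap.adjoint_inner_left]

theorem PiLp.finiteDimensional_range_diagonalCLM {T : E → H →L[ℂ] H}
    (hT : ∀ i, FiniteDimensional ℂ (LinearMap.range (T i).toLinearMap)) :
    FiniteDimensional ℂ (LinearMap.range (PiLp.diagonalCLM T).toLinearMap) := by
  let f : LinearMap.range (PiLp.diagonalCLM T).toLinearMap →ₗ[ℂ]
      ((i : E) → LinearMap.range (T i).toLinearMap) :=
    LinearMap.pi fun i => LinearMap.codRestrict _
      ((PiLp.projₗ 2 (fun _ : E => H) i).comp (Submodule.subtype _)) fun ξ => by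
        obtain ⟨_, η, rfl⟩ := ξ
        exact ⟨η i, rfl⟩
  refine FiniteDimensional.of_injective f fun ξ η h => ?_
  refine Subtype.ext (PiLp.ext fun i => ?_)
  exact congrArg Subtype.val (congrFun h i)

end Diagonal

/-! ### Compressions to the range of an isometry -/

section Commutator

theorem finiteDimensional_range_conj {𝓔 𝓕 : Type*} [NormedAddCommGroup 𝓔]
    [NormedSpace ℂ 𝓔] [NormedAddCommGroup 𝓕] [NormedSpace ℂ 𝓕] (W : 𝓔 →L[ℂ] 𝓕) (V : 𝓕 →L[ℂ] 𝓔) {p : 𝓔 →L[ℂ] 𝓔}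
    (hp : FiniteDimensional ℂ (LinearMap.range p.toLinearMap)) :
    FiniteDimensional ℂ (LinearMap.range (W ∘L p ∘L V).toLinearMap) := by
  refine Submodule.finiteDimensional_of_le
    (S₂ := (LinearMap.range p.toLinearMap).map W.toLinearMap) ?_
  rintro _ ⟨x, rfl⟩
  exact ⟨p (V x), ⟨V x, rfl⟩, rfl⟩

variable {𝓔 𝓕 : Type*} [NormedAddCommGroup 𝓔] [InnerProductSpace ℂ 𝓔] [CompleteSpace 𝓔]
  [NormedAddCommGroup 𝓕] [InnerProductSpace ℂ 𝓕] [CompleteSpace 𝓕]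

-- With `V = W*`, the commutator splits as `(TW - Wt) p V + W (tp - pt) V + W p (tV - VT)`. The last
-- bracket is minus the adjoint of `T* W - W t*`, so both `T` and `T*` must be almost intertwined.
open ContinuousLinearMap in
theorem norm_commutator_conj_le {W : 𝓔 →L[ℂ] 𝓕} (hW : ‖W‖ ≤ 1) {p t : 𝓔 →L[ℂ] 𝓔} (hp : ‖p‖ ≤ 1)
    {T : 𝓕 →L[ℂ] 𝓕} {ε δ : ℝ} (h1 : ‖T ∘L W - W ∘L t‖ ≤ ε)
    (h2 : ‖adjoint T ∘L W - W ∘L adjoint t‖ ≤ ε) (h3 : ‖t * p - p * t‖ ≤ δ) :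
    ‖T * (W ∘L p ∘L adjoint W) - (W ∘L p ∘L adjoint W) * T‖ ≤ 2 * ε + δ := by
  have hW' : ‖adjoint W‖ ≤ 1 := by rwa [LinearIsometryEquiv.norm_map]
  have h2' : ‖t ∘L adjoint W - adjoint W ∘L T‖ ≤ ε := by
    rw [← LinearIsometryEquiv.norm_map adjoint, map_sub, adjoint_comp, adjoint_comp,
      adjoint_adjoint, norm_sub_rev]
    exact h2
  have key : T * (W ∘L p ∘L adjoint W) - (W ∘L p ∘L adjoint W) * T
      = (T ∘L W - W ∘L t) ∘L (p ∘L adjoint W) + W ∘L ((t * p - p * t) ∘L adjoint W)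
        + W ∘L (p ∘L (t ∘L adjoint W - adjoint W ∘L T)) := by
    ext x
    simp
  have hε : 0 ≤ ε := (norm_nonneg _).trans h1
  have hδ : 0 ≤ δ := (norm_nonneg _).trans h3
  rw [key]
  have e1 : ‖(T ∘L W - W ∘L t) ∘L (p ∘L adjoint W)‖ ≤ ε * (1 * 1) :=
    (opNorm_comp_le _ _).trans (mul_le_mul h1 ((opNorm_comp_le _ _).trans
      (mul_le_mul hp hW' (norm_nonneg _) zero_le_one)) (norm_nonneg _) hε)
  have e2 : ‖W ∘L ((t * p - p * t) ∘L adjoint W)‖ ≤ 1 * (δ * 1) :=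
    (opNorm_comp_le _ _).trans (mul_le_mul hW ((opNorm_comp_le _ _).trans
      (mul_le_mul h3 hW' (norm_nonneg _) hδ)) (norm_nonneg _) zero_le_one)
  have e3 : ‖W ∘L (p ∘L (t ∘L adjoint W - adjoint W ∘L T))‖ ≤ 1 * (1 * ε) :=
    (opNorm_comp_le _ _).trans (mul_le_mul hW ((opNorm_comp_le _ _).trans
      (mul_le_mul hp h2' (norm_nonneg _) zero_le_one)) (norm_nonneg _) zero_le_one)
  refine (norm_add₃_le).trans ?_
  linarith

open ContinuousLinearMap in
theorem isStarProjection_conj (W : 𝓔 →ₗᵢ[ℂ] 𝓕) {p : 𝓔 →L[ℂ] 𝓔} (hp : IsStarProjection p) :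
    IsStarProjection (W.toContinuousLinearMap ∘L p ∘L adjoint W.toContinuousLinearMap) where
  isIdempotentElem := by
    have h : adjoint W.toContinuousLinearMap ∘L W.toContinuousLinearMap = 1 :=
      (norm_map_iff_adjoint_comp_self _).1 W.norm_map
    have hpp : p ∘L p = p := hp.isIdempotentElem
    ext x
    have h' (y : 𝓔) : adjoint W.toContinuousLinearMap (W y) = y := congrArg (fun T => T y) h
    have hpp' (y : 𝓔) : p (p y) = p y := congrArg (fun T => T y) hpp
    simp [h', hpp']
  isSelfAdjoint := by
    have hpp : adjoint p = p := hp.isSelfAdjoint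
    rw [isSelfAdjoint_iff', adjoint_comp, adjoint_comp, adjoint_adjoint, hpp, comp_assoc]

/-- Pythagoras. It reduces strong convergence of projections to lower bounds for `‖p x‖`. -/
theorem IsStarProjection.norm_sub_apply_sq {p : 𝓔 →L[ℂ] 𝓔} (hp : IsStarProjection p) (x : 𝓔) :
    ‖p x - x‖ ^ 2 = ‖x‖ ^ 2 - ‖p x‖ ^ 2 := by
  have hpp : p (p x) = p x := congrArg (fun T => T x) hp.isIdempotentElem
  have h : inner ℂ (p x) (x - p x) = 0 := by
    have := ContinuousLinearMap.adjoint_inner_left p (x - p x) x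
    rw [← ContinuousLinearMap.star_eq_adjoint, hp.isSelfAdjoint.star_eq, map_sub, hpp, sub_self,
      inner_zero_right] at this
    exact this
  have := norm_add_sq_eq_norm_sq_add_norm_sq_of_inner_eq_zero (p x) (x - p x) h
  rw [add_sub_cancel] at this
  rw [norm_sub_rev]
  linarith

end Commutator

/-! ### Tilings -/

section Tiling

variable {G : Type v} [Group G] {L : Subgroup G} {K : Finset G}

/-- The representative in the tile `K` of a coset of `L`. -/
def tileRep (hK : Subgroup.IsComplement (K : Set G) (L : Set G)) (q : G ⧸ L) : G :=
  ((Subgroup.isComplement_subgroup_right_iff_existsUnique_quotientGroupMk.1 hK q).choose : G)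

theorem tileRep_mem (hK : Subgroup.IsComplement (K : Set G) (L : Set G)) (q : G ⧸ L) :
    tileRep hK q ∈ K :=
  (Subgroup.isComplement_subgroup_right_iff_existsUnique_quotientGroupMk.1 hK q).choose.2

theorem mk_tileRep (hK : Subgroup.IsComplement (K : Set G) (L : Set G)) (q : G ⧸ L) :
    ((tileRep hK q : G) : G ⧸ L) = q :=
  (Subgroup.isComplement_subgroup_right_iff_existsUnique_quotientGroupMk.1 hK q).choose_spec.1

theorem tileRep_mk (hK : Subgroup.IsComplement (K : Set G) (L : Set G)) {k : G} (hk : k ∈ K) :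
    tileRep hK (k : G ⧸ L) = k :=
  (congrArg Subtype.val ((Subgroup.isComplement_subgroup_right_iff_existsUnique_quotientGroupMk.1
    hK k).choose_spec.2 ⟨k, hk⟩ rfl)).symm

-- In each coset `q` exactly one `s` satisfies `f * s ∈ K`, namely `f⁻¹` times the tile
-- representative of `f • q`.
open scoped Classical in
theorem hasSum_translate_tile [Fintype (G ⧸ L)]
    (hK : Subgroup.IsComplement (K : Set G) (L : Set G)) (f : G) (ψ : G ⧸ L → ℝ) :
    HasSum (fun s : G => if f * s ∈ K then ψ (s : G ⧸ L) else 0) (∑ q, ψ q) := by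
  have hmk (q : G ⧸ L) : ((f⁻¹ * tileRep hK (f • q) : G) : G ⧸ L) = q := by
    change f⁻¹ • ((tileRep hK (f • q) : G) : G ⧸ L) = q
    rw [mk_tileRep, inv_smul_smul]
  refine (Function.Injective.hasSum_iff (g := fun q : G ⧸ L => f⁻¹ * tileRep hK (f • q))
    (fun q q' h => ?_) fun s hs => ?_).1 ?_
  · rw [← hmk q, ← hmk q']
    exact congrArg _ h
  · refine if_neg fun h => hs ⟨(s : G ⧸ L), ?_⟩
    change f⁻¹ * tileRep hK (f • (s : G ⧸ L)) = s
    rw [MulAction.Quotient.smul_coe, smul_eq_mul, tileRep_mk hK h, inv_mul_cancel_left]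
  · convert hasSum_fintype ψ with q
    simp [hmk, tileRep_mem, Function.comp_def]

open scoped Classical in
/-- The proportion of the left translates of `s` by elements of `F` which lie in `K`. -/
def tileWeight (F K : Finset G) (s : G) : ℝ := (∑ f ∈ F, if f * s ∈ K then 1 else 0) / F.card

theorem tileWeight_nonneg (F K : Finset G) (s : G) : 0 ≤ tileWeight F K s :=
  div_nonneg (Finset.sum_nonneg fun f _ => by split_ifs <;> simp) (Nat.cast_nonneg _)

theorem exists_of_tileWeight_ne_zero {F K : Finset G} {s : G} (h : tileWeight F K s ≠ 0) :
    ∃ f ∈ F, f * s ∈ K := by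
  classical
  by_contra! h'
  refine h ?_
  rw [tileWeight, Finset.sum_eq_zero fun f hf => if_neg (h' f hf), zero_div]

/-- Averaging `hasSum_translate_tile` over `f ∈ F`: the weights sum to `1` on each coset. This is
what makes `tileIsometry` isometric. -/
theorem hasSum_tileWeight_mul [Fintype (G ⧸ L)] {F : Finset G} (hF : F.Nonempty)
    (hK : Subgroup.IsComplement (K : Set G) (L : Set G)) (ψ : G ⧸ L → ℝ) :
    HasSum (fun s : G => tileWeight F K s * ψ (s : G ⧸ L)) (∑ q, ψ q) := by
  classical
  have hpos : (F.card : ℝ) ≠ 0 := by exact_mod_cast hF.card_ne_zero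
  have h := (hasSum_sum (s := F) fun f _ => hasSum_translate_tile hK f ψ).div_const (F.card : ℝ)
  rw [Finset.sum_const, nsmul_eq_mul, mul_div_cancel_left₀ _ hpos] at h
  refine h.congr_fun fun s => ?_
  rw [tileWeight, div_mul_eq_mul_div, Finset.sum_mul]
  simp only [ite_mul, one_mul, zero_mul]

-- The weight at `g⁻¹ s` is the average over `F g⁻¹` in place of `F`, so the common terms cancel.
-- The bound stays a sum of indicators so that `hasSum_translate_tile` can later sum it over `s`.
open scoped Classical in
theorem abs_tileWeight_inv_mul_sub_le (F K : Finset G) (g s : G) :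
    |tileWeight F K (g⁻¹ * s) - tileWeight F K s|
      ≤ (∑ f ∈ F ∆ F.image (fun x => x * g⁻¹), if f * s ∈ K then 1 else 0) / F.card := by
  set h : G → ℝ := fun f => if f * s ∈ K then 1 else 0 with hh
  have h0 (f : G) : 0 ≤ h f := by simp only [hh]; split_ifs <;> simp
  set F' := F.image (fun x => x * g⁻¹) with hF'
  have h1 : tileWeight F K (g⁻¹ * s) = (∑ f ∈ F', h f) / F.card := by
    rw [tileWeight, hF', Finset.sum_image fun x _ y _ hxy => mul_right_cancel hxy]
    simp only [hh, mul_assoc]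
  have h2 : tileWeight F K s = (∑ f ∈ F, h f) / F.card := rfl
  have e1 := Finset.sum_inter_add_sum_sdiff F F' h
  have e2 := Finset.sum_inter_add_sum_sdiff F' F h
  have e3 : ∑ f ∈ F ∆ F', h f = ∑ f ∈ F \ F', h f + ∑ f ∈ F' \ F, h f :=
    Finset.sum_union disjoint_sdiff_sdiff
  have p1 : 0 ≤ ∑ f ∈ F \ F', h f := Finset.sum_nonneg fun f _ => h0 f
  have p2 : 0 ≤ ∑ f ∈ F' \ F, h f := Finset.sum_nonneg fun f _ => h0 f
  rw [h1, h2, ← sub_div, abs_div, Nat.abs_cast]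
  refine div_le_div_of_nonneg_right ?_ (Nat.cast_nonneg _)
  rw [Finset.inter_comm F' F] at e2
  rw [e3, abs_le]
  constructor <;> linarith

end Tiling

end

noncomputable section

/-! ### The isometry associated with a tiling -/

section TileIsometry

/-- Let `x` be the tile representative of `sL`, and choose `f ∈ F` with `f s ∈ K`. Then `x s⁻¹ = x
(f s)⁻¹ f` lies in `K K⁻¹ F`, and it lies in `L` by normality. The automorphism `α x⁻¹` is
isometric. -/
theorem norm_action_sub_action_tileRep_le {G : Type v} [Group G] {L : Subgroup G} [L.Normal]
    {F K : Finset G} {A : Type u} [CStarAlgebra A] {α : G →* (A ≃⋆ₐ[ℂ] A)}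
    (hK : Subgroup.IsComplement (K : Set G) (L : Set G)) {a : A} {ε : ℝ}
    (ha : ∀ l ∈ (L : Set G) ∩ ((K : Set G) * (K : Set G)⁻¹ * (F : Set G)), ‖α l a - a‖ ≤ ε)
    {s : G} (hs : tileWeight F K s ≠ 0) :
    ‖α s⁻¹ a - α (tileRep hK (s : G ⧸ L))⁻¹ a‖ ≤ ε := by
  set x := tileRep hK (s : G ⧸ L) with hx
  obtain ⟨f, hf, hfs⟩ := exists_of_tileWeight_ne_zero hs
  have hxL : x⁻¹ * s ∈ L := QuotientGroup.eq.1 (mk_tileRep hK (s : G ⧸ L))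
  have hl : x * s⁻¹ ∈ (L : Set G) ∩ ((K : Set G) * (K : Set G)⁻¹ * (F : Set G)) := by
    constructor
    · have := ‹L.Normal›.conj_mem _ (L.inv_mem hxL) x
      simpa [mul_assoc] using this
    · refine ⟨x * (f * s)⁻¹, ⟨x, tileRep_mem hK _, (f * s)⁻¹, Set.inv_mem_inv.2 hfs, rfl⟩, f, hf, ?_⟩
      simp [mul_assoc]
  refine le_of_eq_of_le ?_ (ha _ hl)
  have h1 : α s⁻¹ a - α x⁻¹ a = α x⁻¹ (α (x * s⁻¹) a - a) := by
    rw [map_sub, TwistedConv.action_mul_apply, inv_mul_cancel_left]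
  rw [h1, StarAlgEquiv.norm_map]

variable {G : Type v} [Group G] {L : Subgroup G} {F K : Finset G} [Fintype (G ⧸ L)]
  {H : Type w} [NormedAddCommGroup H] [InnerProductSpace ℂ H]

theorem norm_sqrt_smul_sq {x : ℝ} (hx : 0 ≤ x) (h : H) : ‖((√x : ℝ) : ℂ) • h‖ ^ 2 = x * ‖h‖ ^ 2 := by
  rw [norm_smul, mul_pow, Complex.norm_real, Real.norm_eq_abs, sq_abs, Real.sq_sqrt hx]

variable (H) in
/-- The isometry `H^(G/L) → ℓ²(G, H)`, `(Wh)(s) = φ(s)^(1/2) h(sL)`, where `φ` is the weight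
function of the tiling. -/
def tileIsometry (hF : F.Nonempty) (hK : Subgroup.IsComplement (K : Set G) (L : Set G)) :
    PiLp 2 (fun _ : G ⧸ L => H) →ₗᵢ[ℂ] lp (fun _ : G => H) 2 where
  toFun h := ⟨fun s => ((√(tileWeight F K s) : ℝ) : ℂ) • h (s : G ⧸ L),
    memℓp_two_iff_summable_sq.2 (by
      simp only [norm_sqrt_smul_sq (tileWeight_nonneg _ _ _)]
      exact (hasSum_tileWeight_mul hF hK fun q => ‖h q‖ ^ 2).summable)⟩
  map_add' h h' := lp.ext (funext fun s => smul_add _ _ _)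
  map_smul' c h := lp.ext (funext fun s => smul_comm _ _ _)
  norm_map' h := by
    rw [← sq_eq_sq₀ (norm_nonneg _) (norm_nonneg _), PiLp.norm_sq_eq_of_L2]
    refine (lp.hasSum_norm_sq _).unique ?_
    exact (hasSum_tileWeight_mul hF hK fun q => ‖h q‖ ^ 2).congr_fun fun s =>
      norm_sqrt_smul_sq (tileWeight_nonneg _ _ _) _

theorem tileIsometry_apply (hF : F.Nonempty) (hK : Subgroup.IsComplement (K : Set G) (L : Set G))
    (h : PiLp 2 (fun _ : G ⧸ L => H)) (s : G) :
    tileIsometry H hF hK h s = ((√(tileWeight F K s) : ℝ) : ℂ) • h (s : G ⧸ L) := rfl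

variable (L H) in
/-- The left translation by `g` on `H^(G/L)`. -/
def cosetTranslation (g : G) : PiLp 2 (fun _ : G ⧸ L => H) →L[ℂ] PiLp 2 (fun _ : G ⧸ L => H) :=
  (LinearIsometryEquiv.piLpCongrLeft 2 ℂ H (MulAction.toPerm g : Equiv.Perm (G ⧸ L)))

@[simp]
theorem cosetTranslation_apply (g : G) (x : PiLp 2 (fun _ : G ⧸ L => H)) (q : G ⧸ L) :
    cosetTranslation L H g x q = x (g⁻¹ • q) := rfl

variable [CompleteSpace H]

theorem adjoint_cosetTranslation (g : G) :
    ContinuousLinearMap.adjoint (cosetTranslation L H g) = cosetTranslation L H g⁻¹ := by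
  refine ((ContinuousLinearMap.eq_adjoint_iff _ _).2 fun x y => ?_).symm
  simp only [PiLp.inner_apply, cosetTranslation_apply, inv_inv]
  refine Fintype.sum_equiv (MulAction.toPerm g) _ _ fun q => ?_
  simp

theorem adjoint_leftTranslation (g : G) :
    ContinuousLinearMap.adjoint
      (leftTranslation G H g : lp (fun _ : G => H) 2 →L[ℂ] lp (fun _ : G => H) 2)
      = (leftTranslation G H g⁻¹ : lp (fun _ : G => H) 2 →L[ℂ] lp (fun _ : G => H) 2) := by
  rw [map_inv, ← Unitary.star_eq_inv, Unitary.coe_star, ContinuousLinearMap.star_eq_adjoint]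

open scoped Classical in
theorem adjoint_tileIsometry_single (hF : F.Nonempty)
    (hK : Subgroup.IsComplement (K : Set G) (L : Set G)) (g : G) (h : H) :
    ContinuousLinearMap.adjoint (tileIsometry H hF hK).toContinuousLinearMap (lp.single 2 g h)
      = PiLp.single 2 (g : G ⧸ L) (((√(tileWeight F K g) : ℝ) : ℂ) • h) := by
  refine ext_inner_right ℂ fun x => ?_
  rw [ContinuousLinearMap.adjoint_inner_left, LinearIsometry.coe_toContinuousLinearMap,
    lp.inner_single_left, tileIsometry_apply, PiLp.inner_apply,
    Finset.sum_eq_single (g : G ⧸ L) (fun q _ hq => by simp [hq]) (by simp)]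
  rw [PiLp.single_eq_same, inner_smul_left, inner_smul_right, Complex.conj_ofReal]

-- At `s` the difference is `(φ(g⁻¹s)^(1/2) - φ(s)^(1/2)) h(g⁻¹sL)`, with `φ` the tile weight. Its
-- square is bounded through `|φ(g⁻¹s) - φ(s)|`, hence by indicators indexed by `F ∆ F g⁻¹`, each of
-- which contributes `‖h‖²` after summation.
open scoped Classical in
theorem norm_leftTranslation_comp_tileIsometry_sub_le (hF : F.Nonempty)
    (hK : Subgroup.IsComplement (K : Set G) (L : Set G)) (g : G) :
    ‖(leftTranslation G H g : lp (fun _ : G => H) 2 →L[ℂ] lp (fun _ : G => H) 2) ∘L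
        (tileIsometry H hF hK).toContinuousLinearMap -
      (tileIsometry H hF hK).toContinuousLinearMap ∘L
        cosetTranslation L H g‖
      ≤ √((F ∆ F.image (fun x => x * g⁻¹)).card / F.card) := by
  refine ContinuousLinearMap.opNorm_le_bound _ (Real.sqrt_nonneg _) fun h => ?_
  set D := F ∆ F.image (fun x => x * g⁻¹) with hD
  let ψ : G ⧸ L → ℝ := fun q => ‖h (g⁻¹ • q)‖ ^ 2
  have hψ : ∑ q, ψ q = ‖h‖ ^ 2 := by
    rw [PiLp.norm_sq_eq_of_L2]
    exact Equiv.sum_comp (MulAction.toPerm g⁻¹ : Equiv.Perm (G ⧸ L)) fun q => ‖h q‖ ^ 2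
  have hsum := (hasSum_sum (s := D) fun f _ => hasSum_translate_tile hK f ψ).div_const
    (F.card : ℝ)
  refine lp.norm_le_of_hasSum_sq_le (by positivity) (g := fun s =>
    (∑ f ∈ D, if f * s ∈ K then ψ (s : G ⧸ L) else 0) / F.card) ?_ fun s => ?_
  · have hc : (√(D.card / F.card : ℝ) * ‖h‖) ^ 2 = (∑ f ∈ D, ∑ q, ψ q) / F.card := by
      rw [mul_pow, Real.sq_sqrt (by positivity), Finset.sum_const, nsmul_eq_mul, hψ]
      ring
    rw [hc]
    exact hsum
  · have key : (((leftTranslation G H g : lp (fun _ : G => H) 2 →L[ℂ] lp (fun _ : G => H) 2) ∘L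
        (tileIsometry H hF hK).toContinuousLinearMap -
      (tileIsometry H hF hK).toContinuousLinearMap ∘L
        cosetTranslation L H g) h) s
        = ((√(tileWeight F K (g⁻¹ * s)) - √(tileWeight F K s) : ℝ) : ℂ) •
          h (g⁻¹ • (s : G ⧸ L)) := by
      rw [Complex.ofReal_sub, sub_smul]
      rfl
    rw [key, norm_smul, mul_pow, Complex.norm_real, Real.norm_eq_abs, sq_abs]
    -- `(√x - √y)² ≤ |√x - √y| (√x + √y) = |x - y|`.
    have h1 : (√(tileWeight F K (g⁻¹ * s)) - √(tileWeight F K s)) ^ 2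
        ≤ |tileWeight F K (g⁻¹ * s) - tileWeight F K s| := by
      have ha := Real.sq_sqrt (tileWeight_nonneg F K (g⁻¹ * s))
      have hb := Real.sq_sqrt (tileWeight_nonneg F K s)
      have ha' := Real.sqrt_nonneg (tileWeight F K (g⁻¹ * s))
      have hb' := Real.sqrt_nonneg (tileWeight F K s)
      rw [← ha, ← hb, sq_sub_sq, abs_mul, ← sq_abs (_ - _), sq, abs_of_nonneg (add_nonneg
        (Real.sqrt_nonneg _) (Real.sqrt_nonneg _)), Real.sqrt_sq ha', Real.sqrt_sq hb']
      refine mul_le_mul_of_nonneg_right ?_ (abs_nonneg _)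
      exact abs_le.2 ⟨by linarith, by linarith⟩
    calc _ ≤ |tileWeight F K (g⁻¹ * s) - tileWeight F K s| * ψ (s : G ⧸ L) :=
          mul_le_mul_of_nonneg_right h1 (sq_nonneg _)
      _ ≤ ((∑ f ∈ D, if f * s ∈ K then 1 else 0) / F.card) * ψ (s : G ⧸ L) :=
          mul_le_mul_of_nonneg_right (abs_tileWeight_inv_mul_sub_le F K g s) (sq_nonneg _)
      _ = _ := by
          rw [div_mul_eq_mul_div, Finset.sum_mul]
          simp only [ite_mul, one_mul, zero_mul]

variable {A : Type u} [CStarAlgebra A] {α : G →* (A ≃⋆ₐ[ℂ] A)}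

/-- The difference at `s` carries the factor `φ(s)^(1/2)`, so only the support of the weight `φ`
matters, and summation uses that `φ` has total mass `1` on each coset. -/
theorem norm_regularAlgHom_comp_tileIsometry_sub_le (hF : F.Nonempty)
    (hK : Subgroup.IsComplement (K : Set G) (L : Set G)) (σ : A →⋆ₐ[ℂ] (H →L[ℂ] H)) {a : A}
    {ε : ℝ} (hε : 0 ≤ ε) (ha : ∀ s : G, tileWeight F K s ≠ 0 →
      ‖α s⁻¹ a - α (tileRep hK (s : G ⧸ L))⁻¹ a‖ ≤ ε) :
    ‖regularAlgHom α σ a ∘L (tileIsometry H hF hK).toContinuousLinearMap -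
      (tileIsometry H hF hK).toContinuousLinearMap ∘L
        PiLp.diagonalCLM fun q => σ (α (tileRep hK q)⁻¹ a)‖ ≤ ε := by
  refine ContinuousLinearMap.opNorm_le_bound _ hε fun h => ?_
  refine lp.norm_le_of_hasSum_sq_le (by positivity) (g := fun s =>
    ε ^ 2 * (tileWeight F K s * ‖h (s : G ⧸ L)‖ ^ 2)) ?_ fun s => ?_
  · rw [mul_pow, PiLp.norm_sq_eq_of_L2]
    exact (hasSum_tileWeight_mul hF hK fun q => ‖h q‖ ^ 2).mul_left _
  · have key : ((regularAlgHom α σ a ∘L (tileIsometry H hF hK).toContinuousLinearMap -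
      (tileIsometry H hF hK).toContinuousLinearMap ∘L
        PiLp.diagonalCLM fun q => σ (α (tileRep hK q)⁻¹ a)) h) s
        = ((√(tileWeight F K s) : ℝ) : ℂ) •
          σ (α s⁻¹ a - α (tileRep hK (s : G ⧸ L))⁻¹ a) (h (s : G ⧸ L)) := by
      change σ (α s⁻¹ a) (((√(tileWeight F K s) : ℝ) : ℂ) • h (s : G ⧸ L)) -
        ((√(tileWeight F K s) : ℝ) : ℂ) • σ (α (tileRep hK (s : G ⧸ L))⁻¹ a) (h (s : G ⧸ L)) = _
      rw [map_smul, ← smul_sub, map_sub]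
      rfl
    rw [key, norm_sqrt_smul_sq (tileWeight_nonneg _ _ _)]
    by_cases hs : tileWeight F K s = 0
    · simp [hs]
    · have h1 : ‖σ (α s⁻¹ a - α (tileRep hK (s : G ⧸ L))⁻¹ a) (h (s : G ⧸ L))‖
          ≤ ε * ‖h (s : G ⧸ L)‖ :=
        ContinuousLinearMap.le_of_opNorm_le _
          ((NonUnitalStarAlgHom.norm_apply_le σ _).trans (ha s hs)) _
      have h2 := pow_le_pow_left₀ (norm_nonneg _) h1 2
      calc _ ≤ tileWeight F K s * (ε * ‖h (s : G ⧸ L)‖) ^ 2 :=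
            mul_le_mul_of_nonneg_left h2 (tileWeight_nonneg _ _ _)
        _ = _ := by ring

end TileIsometry

end

noncomputable section

/-! ### Operators asymptotically commuting with a sequence -/

section AsymptoticCommutator

variable {H : Type w} [NormedAddCommGroup H] [InnerProductSpace ℂ H] [CompleteSpace H]

/-- The operators which asymptotically commute with a sequence of operators. -/
def asymptoticCommutant (P : ℕ → (H →L[ℂ] H)) : Submodule ℂ (H →L[ℂ] H) where
  carrier := {T | Tendsto (fun n => T * P n - P n * T) atTop (𝓝 0)}
  zero_mem' := by simp
  add_mem' {S T} hS hT := by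
    have := Tendsto.add hS hT
    rw [add_zero] at this
    refine this.congr fun n => ?_
    rw [add_mul, mul_add]
    abel
  smul_mem' c T hT := by
    have := Tendsto.const_smul hT c
    rw [smul_zero] at this
    refine this.congr fun n => ?_
    rw [smul_mul_assoc, mul_smul_comm, smul_sub]

theorem mem_asymptoticCommutant_iff {P : ℕ → (H →L[ℂ] H)} {T : H →L[ℂ] H} :
    T ∈ asymptoticCommutant P ↔ Tendsto (fun n => ‖T * P n - P n * T‖) atTop (𝓝 0) :=
  tendsto_zero_iff_norm_tendsto_zero

theorem isClosed_asymptoticCommutant {P : ℕ → (H →L[ℂ] H)} (hP : ∀ n, ‖P n‖ ≤ 1) :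
    IsClosed (asymptoticCommutant P : Set (H →L[ℂ] H)) := by
  refine isClosed_of_closure_subset fun T hT => mem_asymptoticCommutant_iff.2 ?_
  rw [Metric.tendsto_atTop]
  intro ε hε
  obtain ⟨S, hS, hST⟩ := Metric.mem_closure_iff.1 hT (ε / 4) (by positivity)
  obtain ⟨N, hN⟩ := Metric.tendsto_atTop.1 (mem_asymptoticCommutant_iff.1 hS) (ε / 4) (by positivity)
  refine ⟨N, fun n hn => ?_⟩
  have h1 := hN n hn
  rw [dist_zero_right, norm_norm] at h1 ⊢
  rw [dist_eq_norm] at hST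
  have h2 : ‖(T - S) * P n‖ ≤ ‖T - S‖ :=
    (norm_mul_le _ _).trans (mul_le_of_le_one_right (norm_nonneg _) (hP n))
  have h3 : ‖P n * (T - S)‖ ≤ ‖T - S‖ :=
    (norm_mul_le _ _).trans (mul_le_of_le_one_left (norm_nonneg _) (hP n))
  have h4 : T * P n - P n * T = ((T - S) * P n - P n * (T - S)) + (S * P n - P n * S) := by
    rw [sub_mul, mul_sub]
    abel
  rw [h4]
  have h5 := norm_add_le ((T - S) * P n - P n * (T - S)) (S * P n - P n * S)
  have h6 := norm_sub_le ((T - S) * P n) (P n * (T - S))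
  linarith

/-- Leibniz rule: `[ST, P] = S [T, P] + [S, P] T`. -/
theorem mul_mem_asymptoticCommutant {P : ℕ → (H →L[ℂ] H)} {S T : H →L[ℂ] H}
    (hS : S ∈ asymptoticCommutant P) (hT : T ∈ asymptoticCommutant P) :
    S * T ∈ asymptoticCommutant P := by
  have h := (Tendsto.const_mul S hT).add (Tendsto.mul_const T hS)
  rw [mul_zero, zero_mul, add_zero] at h
  refine h.congr fun n => ?_
  rw [mul_sub, sub_mul]
  simp only [mul_assoc]
  abel

end AsymptoticCommutator

theorem tendsto_apply_of_dense_span {H : Type*} [NormedAddCommGroup H] [NormedSpace ℂ H]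
    {P : ℕ → (H →L[ℂ] H)} (hP : ∀ n, ‖P n‖ ≤ 1) {S : Set H}
    (hS : Dense (Submodule.span ℂ S : Set H)) (h : ∀ x ∈ S, Tendsto (fun n => P n x) atTop (𝓝 x))
    (x : H) : Tendsto (fun n => P n x) atTop (𝓝 x) := by
  have hspan : ∀ y ∈ Submodule.span ℂ S, Tendsto (fun n => P n y) atTop (𝓝 y) := by
    intro y hy
    induction hy using Submodule.span_induction with
    | mem y hy => exact h y hy
    | zero => simp
    | add y z _ _ hy hz => simpa using hy.add hz
    | smul c y _ hy => simpa using hy.const_smul c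
  rw [Metric.tendsto_atTop]
  intro ε hε
  obtain ⟨y, hy, hxy⟩ := Metric.mem_closure_iff.1 (hS x) (ε / 3) (by positivity)
  obtain ⟨N, hN⟩ := Metric.tendsto_atTop.1 (hspan y hy) (ε / 3) (by positivity)
  refine ⟨N, fun n hn => ?_⟩
  have h1 : dist (P n x) (P n y) ≤ dist x y := by
    rw [dist_eq_norm, dist_eq_norm, ← map_sub]
    simpa using (P n).le_of_opNorm_le (hP n) (x - y)
  have h2 := dist_triangle4 (P n x) (P n y) y x
  have h3 := hN n hn
  rw [dist_comm y x] at h2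
  linarith

/-! ### Representations of the full crossed product -/

section CrossedProductRep

variable {A : Type u} [CStarAlgebra A] {G : Type v} [Group G] {α : G →* (A ≃⋆ₐ[ℂ] A)}
  {H : Type (max u v)} [NormedAddCommGroup H] [InnerProductSpace ℂ H] [CompleteSpace H]

theorem CovariantRep.isometry_integrated {π : CovariantRep α H}
    (hπ : ∀ f : TwistedConv α, ‖f‖ ≤ ‖π.integrated f‖) : Isometry π.integrated :=
  AddMonoidHomClass.isometry_of_norm π.integrated fun f =>
    le_antisymm (TwistedConv.norm_integrated_le π f) (hπ f)

/-- The representation of the full crossed product extending an isometric covariant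
representation. -/
def CovariantRep.extension (π : CovariantRep α H)
    (hπ : ∀ f : TwistedConv α, ‖f‖ ≤ ‖π.integrated f‖) :
    FullCrossedProduct α →⋆ₐ[ℂ] (H →L[ℂ] H) :=
  let Φ : FullCrossedProduct α →+* (H →L[ℂ] H) :=
    UniformSpace.Completion.extensionHom (π.integrated : TwistedConv α →+* (H →L[ℂ] H))
      (π.isometry_integrated hπ).continuous
  have hcont : Continuous Φ := UniformSpace.Completion.continuous_extension
  have hof (f : TwistedConv α) : Φ (FullCrossedProduct.of f) = π.integrated f :=
    UniformSpace.Completion.extensionHom_coe _ _ f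
  { Φ with
    commutes' := fun c => by
      change Φ _ = _
      have h : algebraMap ℂ (FullCrossedProduct α) c = FullCrossedProduct.of (algebraMap ℂ _ c) :=
        rfl
      rw [h, hof, AlgHomClass.commutes]
    map_star' := fun x => by
      change Φ (star x) = star (Φ x)
      refine FullCrossedProduct.denseRange_of.induction_on x
        (isClosed_eq (hcont.comp FullCrossedProduct.continuous_star') hcont.star) fun f => ?_
      rw [FullCrossedProduct.star_of, hof, hof, map_star] }

theorem CovariantRep.extension_of (π : CovariantRep α H)
    (hπ : ∀ f : TwistedConv α, ‖f‖ ≤ ‖π.integrated f‖) (f : TwistedConv α) :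
    π.extension hπ (FullCrossedProduct.of f) = π.integrated f :=
  UniformSpace.Completion.extensionHom_coe _ (π.isometry_integrated hπ).continuous f

theorem CovariantRep.isometry_extension (π : CovariantRep α H)
    (hπ : ∀ f : TwistedConv α, ‖f‖ ≤ ‖π.integrated f‖) : Isometry (π.extension hπ) :=
  (π.isometry_integrated hπ).completion_extension

/-- The full crossed product is quasidiagonal if there is an isometric covariant representation
whose operators asymptotically commute with a suitable sequence of projections. -/
theorem CovariantRep.isQuasidiagonal_fullCrossedProduct [Countable G]
    [TopologicalSpace.SeparableSpace A] [TopologicalSpace.SeparableSpace H]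
    (π : CovariantRep α H) (hπ : ∀ f : TwistedConv α, ‖f‖ ≤ ‖π.integrated f‖)
    (P : ℕ → (H →L[ℂ] H)) (hP : ∀ n, IsStarProjection (P n))
    (hfin : ∀ n, FiniteDimensional ℂ (LinearMap.range (P n).toLinearMap))
    (hlim : ∀ h : H, Tendsto (fun n => P n h) atTop (𝓝 h))
    (hσ : ∀ a, π.σ a ∈ asymptoticCommutant P)
    (hu : ∀ g, (π.u g : H →L[ℂ] H) ∈ asymptoticCommutant P) :
    IsQuasidiagonal (FullCrossedProduct α) := by
  let D : Set (H →L[ℂ] H) := ⋃ g : G, Set.range fun a : A => π.σ a * (π.u g : H →L[ℂ] H)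
  have hσc : Continuous π.σ := by
    refine AddMonoidHomClass.continuous_of_bound π.σ 1 fun a => ?_
    rw [one_mul]
    exact NonUnitalStarAlgHom.norm_apply_le π.σ a
  have hspan : Set.range (π.extension hπ) ⊆ closure (Submodule.span ℂ D : Set (H →L[ℂ] H)) := by
    rintro _ ⟨x, rfl⟩
    refine FullCrossedProduct.denseRange_of.induction_on x
      (isClosed_closure.preimage (π.isometry_extension hπ).continuous) fun f => subset_closure ?_
    rw [π.extension_of]
    induction f using TwistedConv.induction with
    | zero => rw [map_zero]; exact Submodule.zero_mem _
    | add x y hx hy => rw [map_add]; exact Submodule.add_mem _ hx hy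
    | single g a =>
      rw [π.integrated_single]
      exact Submodule.subset_span (Set.mem_iUnion.2 ⟨g, a, rfl⟩)
  refine ⟨H, inferInstance, inferInstance, inferInstance, inferInstance, π.extension hπ,
    (π.isometry_extension hπ).injective, ?_, P, fun n => ⟨hP n, hfin n⟩, hlim, D, ?_, hspan, ?_⟩
  · refine TopologicalSpace.IsSeparable.mono (TopologicalSpace.IsSeparable.closure
      (TopologicalSpace.IsSeparable.span ?_)) hspan
    exact TopologicalSpace.IsSeparable.iUnion fun g =>
      TopologicalSpace.isSeparable_range (hσc.mul continuous_const)
  · intro T hT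
    obtain ⟨g, a, rfl⟩ := Set.mem_iUnion.1 hT
    exact ⟨FullCrossedProduct.of (TwistedConv.single α g a), by
      rw [π.extension_of, π.integrated_single]⟩
  · intro T hT
    obtain ⟨g, a, rfl⟩ := Set.mem_iUnion.1 hT
    exact mem_asymptoticCommutant_iff.1 (mul_mem_asymptoticCommutant (hσ a) (hu g))

end CrossedProductRep

/-! ### The projections associated with a tiling -/

section TileProjection

variable {G : Type v} [Group G] {L : Subgroup G} {F K : Finset G} [Fintype (G ⧸ L)]
  {H : Type w} [NormedAddCommGroup H] [InnerProductSpace ℂ H] [CompleteSpace H]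

/-- The projection on `ℓ²(G, H)` whose range is the image of `(pH)^(G/L)` under the isometry of
the tiling. -/
def tileProjection (hF : F.Nonempty) (hK : Subgroup.IsComplement (K : Set G) (L : Set G))
    (p : H →L[ℂ] H) : lp (fun _ : G => H) 2 →L[ℂ] lp (fun _ : G => H) 2 :=
  (tileIsometry H hF hK).toContinuousLinearMap ∘L (PiLp.diagonalCLM fun _ => p) ∘L
    ContinuousLinearMap.adjoint (tileIsometry H hF hK).toContinuousLinearMap

theorem isStarProjection_diagonalCLM {E : Type*} [Fintype E] {p : H →L[ℂ] H}
    (hp : IsStarProjection p) :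
    IsStarProjection (PiLp.diagonalCLM fun _ : E => p) where
  isIdempotentElem := by
    have hpp (x : H) : p (p x) = p x := congrArg (fun T => T x) hp.isIdempotentElem
    ext x i
    simp [hpp]
  isSelfAdjoint := by
    have hpp : ContinuousLinearMap.adjoint p = p := hp.isSelfAdjoint
    rw [ContinuousLinearMap.isSelfAdjoint_iff', PiLp.adjoint_diagonalCLM, hpp]

theorem isStarProjection_tileProjection (hF : F.Nonempty)
    (hK : Subgroup.IsComplement (K : Set G) (L : Set G)) {p : H →L[ℂ] H}
    (hp : IsStarProjection p) : IsStarProjection (tileProjection hF hK p) :=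
  isStarProjection_conj _ (isStarProjection_diagonalCLM hp)

theorem finiteDimensional_range_tileProjection (hF : F.Nonempty)
    (hK : Subgroup.IsComplement (K : Set G) (L : Set G)) {p : H →L[ℂ] H}
    (hp : FiniteDimensional ℂ (LinearMap.range p.toLinearMap)) :
    FiniteDimensional ℂ (LinearMap.range (tileProjection hF hK p).toLinearMap) :=
  finiteDimensional_range_conj _ _ (PiLp.finiteDimensional_range_diagonalCLM fun _ => hp)

open scoped Classical in
theorem tileProjection_single_apply_self (hF : F.Nonempty)
    (hK : Subgroup.IsComplement (K : Set G) (L : Set G)) (p : H →L[ℂ] H) (g : G) (h : H) :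
    tileProjection hF hK p (lp.single 2 g h) g = (tileWeight F K g : ℂ) • p h := by
  rw [tileProjection, ContinuousLinearMap.comp_apply, ContinuousLinearMap.comp_apply,
    adjoint_tileIsometry_single, LinearIsometry.coe_toContinuousLinearMap, tileIsometry_apply,
    PiLp.diagonalCLM_apply, PiLp.single_eq_same, map_smul, smul_smul, ← Complex.ofReal_mul,
    Real.mul_self_sqrt (tileWeight_nonneg _ _ _)]

-- Pythagoras, with the norm of the projected vector bounded below by that of its coordinate at `g`.
open scoped Classical in
theorem norm_tileProjection_single_sub_sq_le (hF : F.Nonempty)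
    (hK : Subgroup.IsComplement (K : Set G) (L : Set G)) {p : H →L[ℂ] H}
    (hp : IsStarProjection p) (g : G) (h : H) :
    ‖tileProjection hF hK p (lp.single 2 g h) - lp.single 2 g h‖ ^ 2
      ≤ ‖h‖ ^ 2 - (tileWeight F K g * ‖p h‖) ^ 2 := by
  rw [(isStarProjection_tileProjection hF hK hp).norm_sub_apply_sq, lp.norm_single (by norm_num)]
  refine sub_le_sub_left (pow_le_pow_left₀ (mul_nonneg (tileWeight_nonneg _ _ _) (norm_nonneg _)) ?_ 2) _
  calc tileWeight F K g * ‖p h‖ = ‖tileProjection hF hK p (lp.single 2 g h) g‖ := by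
        rw [tileProjection_single_apply_self, norm_smul, Complex.norm_real, Real.norm_eq_abs,
          abs_of_nonneg (tileWeight_nonneg _ _ _)]
    _ ≤ _ := lp.norm_apply_le_norm (by norm_num) _ g

open scoped Classical in
theorem norm_leftTranslation_commutator_tileProjection_le (hF : F.Nonempty)
    (hK : Subgroup.IsComplement (K : Set G) (L : Set G)) {p : H →L[ℂ] H}
    (hp : IsStarProjection p) (g : G) :
    ‖(leftTranslation G H g : lp (fun _ : G => H) 2 →L[ℂ] lp (fun _ : G => H) 2) *
        tileProjection hF hK p -
      tileProjection hF hK p *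
        (leftTranslation G H g : lp (fun _ : G => H) 2 →L[ℂ] lp (fun _ : G => H) 2)‖
      ≤ 2 * (√((F ∆ F.image (fun x => x * g⁻¹)).card / F.card) +
        √((F ∆ F.image (fun x => x * g)).card / F.card)) := by
  have h := norm_leftTranslation_comp_tileIsometry_sub_le (H := H) hF hK g
  have h' := norm_leftTranslation_comp_tileIsometry_sub_le (H := H) hF hK g⁻¹
  rw [inv_inv] at h'
  have hcomm : cosetTranslation L H g * PiLp.diagonalCLM (fun _ => p)
      = PiLp.diagonalCLM (fun _ => p) * cosetTranslation L H g := by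
    ext x q
    simp
  -- Here `δ = 0`, since coset translations commute exactly with `1 ⊗ p`. The two square roots bound
  -- the intertwining errors of `g` and of its adjoint `g⁻¹`; their sum serves as the common `ε`.
  rw [← add_zero (2 * _)]
  refine norm_commutator_conj_le (tileIsometry H hF hK).norm_toContinuousLinearMap_le
    (IsStarProjection.norm_le _ (isStarProjection_diagonalCLM hp)) (t := cosetTranslation L H g)
    (h.trans (le_add_of_nonneg_right (Real.sqrt_nonneg _))) ?_
    (le_of_eq (norm_eq_zero.2 (sub_eq_zero.2 hcomm)))
  rw [adjoint_leftTranslation, adjoint_cosetTranslation]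
  exact h'.trans (le_add_of_nonneg_left (Real.sqrt_nonneg _))

variable {A : Type u} [CStarAlgebra A] {α : G →* (A ≃⋆ₐ[ℂ] A)}

theorem norm_regularAlgHom_commutator_tileProjection_le [L.Normal] (hF : F.Nonempty)
    (hK : Subgroup.IsComplement (K : Set G) (L : Set G)) {p : H →L[ℂ] H}
    (hp : IsStarProjection p) (σ : A →⋆ₐ[ℂ] (H →L[ℂ] H)) {a : A} {ε δ : ℝ} (hε : 0 ≤ ε)
    (hδ : 0 ≤ δ)
    (ha : ∀ l ∈ (L : Set G) ∩ ((K : Set G) * (K : Set G)⁻¹ * (F : Set G)), ‖α l a - a‖ ≤ ε)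
    (hap : ∀ q : G ⧸ L, ‖σ (α (tileRep hK q)⁻¹ a) * p - p * σ (α (tileRep hK q)⁻¹ a)‖ ≤ δ) :
    ‖regularAlgHom α σ a * tileProjection hF hK p - tileProjection hF hK p * regularAlgHom α σ a‖
      ≤ 2 * ε + δ := by
  -- The same bound for `star a` controls the adjoint half of `norm_commutator_conj_le`.
  have ha' : ∀ l ∈ (L : Set G) ∩ ((K : Set G) * (K : Set G)⁻¹ * (F : Set G)),
      ‖α l (star a) - star a‖ ≤ ε := fun l hl => by
    rw [map_star, ← star_sub, norm_star]
    exact ha l hl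
  refine norm_commutator_conj_le (tileIsometry H hF hK).norm_toContinuousLinearMap_le
    (IsStarProjection.norm_le _ (isStarProjection_diagonalCLM hp))
    (t := PiLp.diagonalCLM fun q => σ (α (tileRep hK q)⁻¹ a))
    (norm_regularAlgHom_comp_tileIsometry_sub_le hF hK σ hε fun s hs =>
      norm_action_sub_action_tileRep_le hK ha hs) ?_ ?_
  · rw [PiLp.adjoint_diagonalCLM, ← ContinuousLinearMap.star_eq_adjoint, ← map_star]
    simp only [← ContinuousLinearMap.star_eq_adjoint, ← map_star]
    exact norm_regularAlgHom_comp_tileIsometry_sub_le hF hK σ hε fun s hs =>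
      norm_action_sub_action_tileRep_le hK ha' hs
  · refine le_of_eq_of_le ?_ (PiLp.norm_diagonalCLM_le hδ hap)
    congr 1

end TileProjection

end

/-! ### Asymptotics of the tile weights and projections along the Følner sequence -/

section TileSequence

variable {G : Type v} [Group G] {F K : ℕ → Finset G}

theorem IsFolnerSequence.nonempty (hF : IsFolnerSequence F) (n : ℕ) : (F n).Nonempty :=
  Finset.card_pos.1 (hF.card_pos n)

/-- Since `F n ⊆ K n`, the weight at `g` is at least the proportion of `f ∈ F n` with `f g ∈ F n`.
-/
theorem IsFolnerSequence.tendsto_tileWeight (hF : IsFolnerSequence F) (hFK : ∀ n, F n ⊆ K n)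
    (g : G) : Tendsto (fun n => tileWeight (F n) (K n) g) atTop (𝓝 1) := by
  classical
  refine tendsto_of_tendsto_of_tendsto_of_le_of_le (hF.tendsto_card_filter_mul_mem g)
    tendsto_const_nhds (fun n => ?_) fun n => ?_
  · refine div_le_div_of_nonneg_right ?_ (Nat.cast_nonneg _)
    rw [Finset.sum_boole]
    exact Nat.cast_le.2 (Finset.card_le_card
      (Finset.monotone_filter_right _ fun f _ hf => hFK n hf))
  · refine div_le_one_of_le₀ ?_ (Nat.cast_nonneg _)
    rw [Finset.sum_boole]
    exact Nat.cast_le.2 (Finset.card_filter_le _ _)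

variable {L : ℕ → Subgroup G} [∀ n, Fintype (G ⧸ L n)] {H : Type w} [NormedAddCommGroup H]
  [InnerProductSpace ℂ H] [CompleteSpace H] {p : ℕ → (H →L[ℂ] H)}

theorem IsFolnerSequence.tendsto_tileProjection_apply (hF : IsFolnerSequence F)
    (hFK : ∀ n, F n ⊆ K n)
    (hK : ∀ n, Subgroup.IsComplement (K n : Set G) (L n : Set G))
    (hp : ∀ n, IsStarProjection (p n)) (hlim : ∀ h, Tendsto (fun n => p n h) atTop (𝓝 h))
    (ξ : lp (fun _ : G => H) 2) :
    Tendsto (fun n => tileProjection (hF.nonempty n) (hK n) (p n) ξ) atTop (𝓝 ξ) := by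
  classical
  refine tendsto_apply_of_dense_span
    (fun n => IsStarProjection.norm_le _ (isStarProjection_tileProjection _ _ (hp n)))
    lp.dense_span_single (fun x hx => ?_) ξ
  obtain ⟨g, h, rfl⟩ := Set.mem_iUnion.1 hx
  have h1 : Tendsto (fun n => ‖h‖ ^ 2 - (tileWeight (F n) (K n) g * ‖p n h‖) ^ 2) atTop (𝓝 0) := by
    have := (((hF.tendsto_tileWeight hFK g).mul (hlim h).norm).pow 2).const_sub (‖h‖ ^ 2)
    rwa [one_mul, sub_self] at this
  have h2 := squeeze_zero (fun n => sq_nonneg _) (fun n =>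
    norm_tileProjection_single_sub_sq_le (hF.nonempty n) (hK n) (hp n) g h) h1
  rw [tendsto_iff_norm_sub_tendsto_zero]
  have h3 := h2.sqrt
  simpa only [Real.sqrt_sq (norm_nonneg _), Real.sqrt_zero] using h3

theorem IsFolnerSequence.leftTranslation_mem_asymptoticCommutant (hF : IsFolnerSequence F)
    (hK : ∀ n, Subgroup.IsComplement (K n : Set G) (L n : Set G))
    (hp : ∀ n, IsStarProjection (p n)) (g : G) :
    (leftTranslation G H g : lp (fun _ : G => H) 2 →L[ℂ] lp (fun _ : G => H) 2) ∈
      asymptoticCommutant fun n => tileProjection (hF.nonempty n) (hK n) (p n) := by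
  classical
  rw [mem_asymptoticCommutant_iff]
  refine squeeze_zero (fun n => norm_nonneg _) (fun n =>
    norm_leftTranslation_commutator_tileProjection_le (hF.nonempty n) (hK n) (hp n) g) ?_
  have h := ((hF.tendsto_symmDiff g⁻¹).sqrt.add (hF.tendsto_symmDiff g).sqrt).const_mul 2
  rw [Real.sqrt_zero, add_zero, mul_zero] at h
  convert h

end TileSequence

/-! ### Choice of projections and the main theorem -/

theorem IsQuasidiagonalSet.exists_projections {H : Type w} [NormedAddCommGroup H]
    [InnerProductSpace ℂ H] [CompleteSpace H] {S : Set (H →L[ℂ] H)} (hS : IsQuasidiagonalSet S) :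
    ∃ P : ℕ → (H →L[ℂ] H), (∀ n, IsStarProjection (P n)) ∧
      (∀ n, FiniteDimensional ℂ (LinearMap.range (P n).toLinearMap)) ∧
      (∀ h : H, Tendsto (fun n => P n h) atTop (𝓝 h)) ∧
      ∀ T ∈ S, Tendsto (fun n => ‖T * P n - P n * T‖) atTop (𝓝 0) := by
  obtain ⟨-, P, hP, hlim, D, -, hSD, hD⟩ := hS
  refine ⟨P, fun n => (hP n).1, fun n => (hP n).2, hlim, fun T hT => ?_⟩
  rw [← mem_asymptoticCommutant_iff]
  -- Asymptotic commutation passes from `D` to all of `S` because the asymptotic commutant is a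
  -- closed subspace.
  have hspan : Submodule.span ℂ D ≤ asymptoticCommutant P :=
    Submodule.span_le.2 fun T hT => mem_asymptoticCommutant_iff.2 (hD T hT)
  exact closure_minimal hspan
    (isClosed_asymptoticCommutant fun n => IsStarProjection.norm_le _ (hP n).1) (hSD hT)

theorem theorem7 {G : Type v} [Group G] [Countable G] [Group.ResiduallyFinite G]
    (F K : ℕ → Finset G) (L : ℕ → Subgroup G)
    (hF : IsFolnerSequence F)
    (hFK : ∀ n, F n ⊆ K n)
    (hnormal : ∀ n, (L n).Normal)
    (hindex : ∀ n, (L n).FiniteIndex)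
    (htiling : ∀ n, Subgroup.IsComplement (K n : Set G) (L n : Set G))
    {A : Type u} [CStarAlgebra A] [TopologicalSpace.SeparableSpace A]
    (hA : IsQuasidiagonal A)
    (α : G →* (A ≃⋆ₐ[ℂ] A))
    (hα : ∀ a : A, Tendsto
      (fun n => ⨆ l : ((L n : Set G) ∩ ((K n : Set G) * (K n : Set G)⁻¹ * (F n : Set G)) : Set G),
        ‖α l a - a‖) atTop (𝓝 0)) :
    IsQuasidiagonal (FullCrossedProduct α) := by
  obtain ⟨H, _, _, _, _, ρ, hρ, hS⟩ := hA
  obtain ⟨P, hP, hfin, hlim, hcomm⟩ := hS.exists_projections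
  let _ (n : ℕ) : Fintype (G ⧸ L n) := Subgroup.fintypeQuotientOfFiniteIndex
  let d : ℕ → A := TopologicalSpace.denseSeq A
  -- For fixed `n` only finitely many operators occur, as `G ⧸ L n` is finite and `i ≤ n`, so one
  -- late projection `P m` serves them all. The requirement `m ≥ n` preserves strong convergence to
  -- `1`.
  have hm (n : ℕ) : ∃ m ≥ n, ∀ i ≤ n, ∀ q : G ⧸ L n,
      ‖ρ (α (tileRep (htiling n) q)⁻¹ (d i)) * P m - P m * ρ (α (tileRep (htiling n) q)⁻¹ (d i))‖
        ≤ 1 / ((n : ℝ) + 1) := by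
    have hev : ∀ᶠ m in atTop, ∀ i ∈ Set.Iic n, ∀ q : G ⧸ L n,
        ‖ρ (α (tileRep (htiling n) q)⁻¹ (d i)) * P m -
          P m * ρ (α (tileRep (htiling n) q)⁻¹ (d i))‖ ≤ 1 / ((n : ℝ) + 1) := by
      rw [eventually_all_finite (Set.finite_Iic n)]
      refine fun i _ => eventually_all.2 fun q => ?_
      exact (hcomm _ ⟨_, rfl⟩).eventually_le_const (by positivity)
    obtain ⟨m, h1, h2⟩ := ((eventually_ge_atTop n).and hev).exists
    exact ⟨m, h1, h2⟩
  choose m hmn hm using hm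
  have hmtop : Tendsto m atTop atTop := tendsto_atTop_mono hmn tendsto_id
  have hp (n : ℕ) : IsStarProjection (P (m n)) := hP (m n)
  let Q (n : ℕ) := tileProjection (hF.nonempty n) (htiling n) (P (m n))
  have hQ (n : ℕ) : IsStarProjection (Q n) := isStarProjection_tileProjection _ _ (hp n)
  have hσd (i : ℕ) : regularAlgHom α ρ (d i) ∈ asymptoticCommutant Q := by
    rw [mem_asymptoticCommutant_iff]
    have hbd : Tendsto (fun n => 2 * (⨆ l : ((L n : Set G) ∩ ((K n : Set G) * (K n : Set G)⁻¹ *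
        (F n : Set G)) : Set G), ‖α l (d i) - d i‖) + 1 / ((n : ℝ) + 1)) atTop (𝓝 0) := by
      simpa using ((hα (d i)).const_mul 2).add tendsto_one_div_add_atTop_nhds_zero_nat
    refine squeeze_zero' (Eventually.of_forall fun n => norm_nonneg _) ?_ hbd
    -- The element `d i` is controlled by `P (m n)` only from `n = i` onwards.
    filter_upwards [eventually_ge_atTop i] with n hn
    have := hnormal n
    refine norm_regularAlgHom_commutator_tileProjection_le (hF.nonempty n) (htiling n) (hp n) ρ
      (Real.iSup_nonneg fun l => norm_nonneg _) (by positivity) (fun l hl => ?_) (hm n i hn)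
    -- Finiteness makes the real supremum bounded above, hence a genuine upper bound rather than the
    -- default value `0`.
    have hfinite : Finite ((L n : Set G) ∩ ((K n : Set G) * (K n : Set G)⁻¹ *
        (F n : Set G)) : Set G) :=
      Set.Finite.subset (((K n).finite_toSet.mul (K n).finite_toSet.inv).mul (F n).finite_toSet)
        Set.inter_subset_right
    exact le_ciSup (f := fun l : ((L n : Set G) ∩ ((K n : Set G) * (K n : Set G)⁻¹ *
      (F n : Set G)) : Set G) => ‖α l (d i) - d i‖) (Set.finite_range _).bddAbove ⟨l, hl⟩
  have hσ (a : A) : regularAlgHom α ρ a ∈ asymptoticCommutant Q := by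
    have hcont : Continuous (regularAlgHom α ρ) := by
      refine AddMonoidHomClass.continuous_of_bound (regularAlgHom α ρ) 1 fun a => ?_
      rw [one_mul]
      exact NonUnitalStarAlgHom.norm_apply_le _ a
    exact (TopologicalSpace.denseRange_denseSeq A).induction_on a
      ((isClosed_asymptoticCommutant fun n =>
        IsStarProjection.norm_le _ (hQ n)).preimage hcont) hσd
  refine (regularRep α ρ).isQuasidiagonal_fullCrossedProduct (fun f => ?_) Q hQ
    (fun n => finiteDimensional_range_tileProjection _ _ (hfin (m n))) ?_ hσ ?_
  · exact TwistedConv.norm_le (norm_nonneg _) fun H' _ _ _ π => hF.norm_integrated_le π hρ f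
  · exact hF.tendsto_tileProjection_apply hFK htiling hp fun h => (hlim h).comp hmtop
  · exact hF.leftTranslation_mem_asymptoticCommutant htiling hp
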